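/- Let $\beta\in\{1,2\}$. Let $\{Y_i(t)\}_{i\ge1}$ be identically distributed real-valued and $\{Z_{ij}(t)\}_{j>i\ge1}$ identically distributed real-valued ($\beta=1$) or complex-valued ($\beta=2$) stochastic processes indexed by $t\in\mathbb R$, all of them mutually independent, with zero mean and with $\sup_{t}\max(\mathbb E|Z_{12}(t)|^n,\mathbb E|Y_1(t)|^n)<\infty$ for every $n\ge1$. Put $c(s,t)=\frac{\beta}{2}\,\mathbb E\,Y_1(s)Y_1(t)$ and assume that, for all $s,t\in\mathbb R$, $c(s,t)\ge0$ and $c(t,t)=1$, and that - if $\beta=1$: $\mathbb E Z_{12}(s)Z_{12}(t)=c(s,t)$ and $\mathbb E Z_{12}(s)^2Z_{12}(t)^2=2c(s,t)^2+1$; - if $\beta=2$: $\mathbb E Z_{12}(s)Z_{12}(t)=0$, $\mathbb E Z_{12}(s)\overline{Z_{12}(t)}=c(s,t)$ and $\mathbb E |Z_{12}(s)|^2|Z_{12}(t)|^2=c(s,t)^2+1$. Let $X(t)$ be the infinite Hermitian matrix (real symmetric if $\beta=1$) with diagonal entries $Y_i(t)$ and entries $Z_{ij}(t)$ for $i<j$;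 for a finite set $B\subset\{1,2,\dots\}$ let $X_B(t)$ be its submatrix with rows and columns in $B$. Let $T_n$ be the Chebyshev polynomial of the first kind of degree $n$, and $T_n^a(x)=T_n(x/a)$ for $a>0$. Let $k_1,\dots,k_m\ge1$ be integers, $t_1,\dots,t_m\in\mathbb R$, and let $B_1,\dots,B_m$ be finite subsets of $\{1,2,\dots\}$ depending on a parameter $L$ such that the limits $$b_p=\lim_{L\to\infty}\frac{|B_p|}{L}>0,\qquad b_{pq}=\lim_{L\to\infty}\frac{|B_p\cap B_q|}{L},\qquad p,q=1,\dots,m,$$ exist. Then the random variables $\tau_p=\operatorname{tr} T_{k_p}^{2\sqrt{b_pL}}\bigl(X_{B_p}(t_p)\bigr)$ are square integrable for every $L>0$, and for all $p,q=1,\dots,m$ $$\lim_{L\to\infty}\mathbb E\bigl[(\tau_p-\mathbb E\tau_p)(\tau_q-\mathbb E\tau_q)\bigr]=\delta_{k_pk_q}\,\frac{k_p}{2\beta}\left(\frac{c(t_p,t_q)\,b_{pq}}{\sqrt{b_pb_q}}\right)^{k_p}.$$ -/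

import Mathlib

open MeasureTheory ProbabilityTheory Filter Topology

noncomputable section

/-- Positions `(i, j)` with `1 ≤ i < j`, strictly above the diagonal. -/
abbrev UpperPair : Type := {e : ℕ+ × ℕ+ // e.1 < e.2}

/-- The position `(1, 2)`. -/
def pairOneTwo : UpperPair := ⟨(1, 2), by decide⟩

/-- The common part of the real symmetric and the Hermitian definitions. The real processes `Y i`
(diagonal) and the `𝕜`-valued processes `Z e` (above the diagonal) are jointly independent, and
within each family identically distributed, as processes indexed by the time `t : ℝ`, that is, with
respect to the product sigma-algebra on functions of time. They are centred, and each absolute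
moment is bounded uniformly in time. -/
structure IsWignerFamily {Ω : Type*} [MeasurableSpace Ω] (P : Measure Ω) {𝕜 : Type*} [RCLike 𝕜]
    [MeasurableSpace 𝕜] (Y : ℕ+ → ℝ → Ω → ℝ) (Z : UpperPair → ℝ → Ω → 𝕜) : Prop where
  measurable_diag : ∀ i t, Measurable (Y i t)
  measurable_off : ∀ e t, Measurable (Z e t)
  indep : iIndep (Sum.elim
    (fun i : ℕ+ => MeasurableSpace.comap (fun (ω : Ω) (t : ℝ) => Y i t ω) MeasurableSpace.pi)
    (fun e : UpperPair =>
      MeasurableSpace.comap (fun (ω : Ω) (t : ℝ) => Z e t ω) MeasurableSpace.pi)) P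
  identDistrib_diag : ∀ i,
    IdentDistrib (fun (ω : Ω) (t : ℝ) => Y i t ω) (fun (ω : Ω) (t : ℝ) => Y 1 t ω) P P
  identDistrib_off : ∀ e,
    IdentDistrib (fun (ω : Ω) (t : ℝ) => Z e t ω) (fun (ω : Ω) (t : ℝ) => Z pairOneTwo t ω) P P
  mean_diag : ∀ t, ∫ ω, Y 1 t ω ∂P = 0
  mean_off : ∀ t, ∫ ω, Z pairOneTwo t ω ∂P = 0
  moment_diag : ∀ n : ℕ, 1 ≤ n → ∃ M : ℝ, ∀ t,
    Integrable (fun ω => |Y 1 t ω| ^ n) P ∧ ∫ ω, |Y 1 t ω| ^ n ∂P ≤ M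
  moment_off : ∀ n : ℕ, 1 ≤ n → ∃ M : ℝ, ∀ t,
    Integrable (fun ω => ‖Z pairOneTwo t ω‖ ^ n) P ∧ ∫ ω, ‖Z pairOneTwo t ω‖ ^ n ∂P ≤ M

/-- `c(s, t) = (β / 2) E[Y₁(s) Y₁(t)]`. -/
def diagCov {Ω : Type*} [MeasurableSpace Ω] (P : Measure Ω) (β : ℝ) (Y : ℕ+ → ℝ → Ω → ℝ)
    (s t : ℝ) : ℝ :=
  β / 2 * ∫ ω, Y 1 s ω * Y 1 t ω ∂P

/-- The families `Y`, `Z` define a real symmetric time-dependent Wigner matrix (`β = 1`). -/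
structure IsRealWigner {Ω : Type*} [MeasurableSpace Ω] (P : Measure Ω)
    (Y : ℕ+ → ℝ → Ω → ℝ) (Z : UpperPair → ℝ → Ω → ℝ) : Prop
    extends IsWignerFamily P Y Z where
  cov_nonneg : ∀ s t, 0 ≤ diagCov P 1 Y s t
  cov_self : ∀ t, diagCov P 1 Y t t = 1
  off_cov : ∀ s t, ∫ ω, Z pairOneTwo s ω * Z pairOneTwo t ω ∂P = diagCov P 1 Y s t
  off_sq_sq : ∀ s t, ∫ ω, Z pairOneTwo s ω ^ 2 * Z pairOneTwo t ω ^ 2 ∂P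
    = 2 * diagCov P 1 Y s t ^ 2 + 1

/-- The families `Y`, `Z` define a Hermitian time-dependent Wigner matrix (`β = 2`). -/
structure IsHermitianWigner {Ω : Type*} [MeasurableSpace Ω] (P : Measure Ω)
    (Y : ℕ+ → ℝ → Ω → ℝ) (Z : UpperPair → ℝ → Ω → ℂ) : Prop
    extends IsWignerFamily P Y Z where
  cov_nonneg : ∀ s t, 0 ≤ diagCov P 2 Y s t
  cov_self : ∀ t, diagCov P 2 Y t t = 1
  off_prod : ∀ s t, ∫ ω, Z pairOneTwo s ω * Z pairOneTwo t ω ∂P = 0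
  off_cov : ∀ s t, ∫ ω, Z pairOneTwo s ω * star (Z pairOneTwo t ω) ∂P = (diagCov P 2 Y s t : ℂ)
  off_sq_sq : ∀ s t, ∫ ω, ‖Z pairOneTwo s ω‖ ^ 2 * ‖Z pairOneTwo t ω‖ ^ 2 ∂P
    = diagCov P 2 Y s t ^ 2 + 1

/-- The infinite matrix `X(t)` at the sample point `ω`. -/
def wignerMatrix {Ω 𝕜 : Type*} [RCLike 𝕜] (Y : ℕ+ → ℝ → Ω → ℝ) (Z : UpperPair → ℝ → Ω → 𝕜)
    (t : ℝ) (ω : Ω) : Matrix ℕ+ ℕ+ 𝕜 :=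
  fun i j =>
    if h : i < j then Z ⟨(i, j), h⟩ t ω
    else if h' : j < i then star (Z ⟨(j, i), h'⟩ t ω)
    else (Y i t ω : 𝕜)

/-- The submatrix `X_B` of rows and columns with labels in `B`. -/
def principalSub {𝕜 : Type*} (X : Matrix ℕ+ ℕ+ 𝕜) (B : Finset ℕ+) : Matrix B B 𝕜 :=
  X.submatrix Subtype.val Subtype.val

/-- The rescaled Chebyshev polynomial of the first kind, `T_n^a(x) = T_n(x / a)`. -/
def rescaledChebyshev (n : ℕ) (a : ℝ) : Polynomial ℝ :=
  (Polynomial.Chebyshev.T ℝ n).comp (Polynomial.C a⁻¹ * Polynomial.X)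

/-- The random variable `tr T_n^a(X_B(t))`. The trace is a real number, since `X_B(t)` is
Hermitian (`ofReal_chebyshevTrace`); the real part only gives it the type `ℝ`. -/
def chebyshevTrace {Ω 𝕜 : Type*} [RCLike 𝕜] (Y : ℕ+ → ℝ → Ω → ℝ) (Z : UpperPair → ℝ → Ω → 𝕜)
    (n : ℕ) (a : ℝ) (B : Finset ℕ+) (t : ℝ) (ω : Ω) : ℝ :=
  RCLike.re (Matrix.trace
    (Polynomial.aeval (principalSub (wignerMatrix Y Z t ω) B) (rescaledChebyshev n a)))

theorem wignerMatrix_isHermitian {Ω 𝕜 : Type*} [RCLike 𝕜] (Y : ℕ+ → ℝ → Ω → ℝ)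
    (Z : UpperPair → ℝ → Ω → 𝕜) (t : ℝ) (ω : Ω) : (wignerMatrix Y Z t ω).IsHermitian := by
  ext i j
  rw [Matrix.conjTranspose_apply]
  unfold wignerMatrix
  rcases lt_trichotomy i j with h | h | h
  · simp [h, not_lt_of_gt h]
  · subst h
    simp
  · simp [h, not_lt_of_gt h]

theorem ofReal_chebyshevTrace {Ω 𝕜 : Type*} [RCLike 𝕜] (Y : ℕ+ → ℝ → Ω → ℝ)
    (Z : UpperPair → ℝ → Ω → 𝕜) (n : ℕ) (a : ℝ) (B : Finset ℕ+) (t : ℝ) (ω : Ω) :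
    (chebyshevTrace Y Z n a B t ω : 𝕜) = Matrix.trace
      (Polynomial.aeval (principalSub (wignerMatrix Y Z t ω) B) (rescaledChebyshev n a)) := by
  have hX : star (principalSub (wignerMatrix Y Z t ω) B)
      = principalSub (wignerMatrix Y Z t ω) B :=
    (wignerMatrix_isHermitian Y Z t ω).submatrix _
  unfold chebyshevTrace
  rw [← RCLike.conj_eq_iff_re]
  change star _ = _
  rw [← Matrix.trace_conjTranspose, ← Matrix.star_eq_conjTranspose]
  congr 1
  rw [Polynomial.aeval_eq_sum_range, star_sum]
  refine Finset.sum_congr rfl fun i _ => ?_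
  rw [star_smul, star_pow, hX, star_trivial]

end

/-!
Three-term recursions turn Chebyshev traces into sums over closed walks. For an `N × N` matrix `X`,
the polynomial `N ^ (j / 2) U_j(X / (2 √N))` obeys `P (j + 2) = P (j + 1) X - N P j`, and the factor
`N` counts the free middle vertices of backtracks `a → b → a`. Hence
`2 N ^ (k / 2) tr T_k(X / (2 √N))` is the sum over closed walks with `k` steps of a weight
(`cycleWeight`) in which, besides the plain product of entries, disjoint backtracks may be cancelled
at the price of a sign each (`sum_cycleWeight_eq_trace`).

The gain is a cancellation in the covariances of these weights. Suppose that a closed walk with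
`k` steps visits a vertex `a` once, and leaves it along the edge `e`. For `k ≤ 2` the weight is a
function of
the entry at `e` alone. For `k ≥ 3`, if the step into `a` uses another edge, the weight is the
centred entry at `e` times a factor without it; otherwise it is the centred variable `|X e| ^ 2 - 1`
times such a factor. In all cases it is uncorrelated with the weight of every closed walk that does
not use `e`
(`IsWignerOfParameter.bilinCov_cycleWeight_eq_zero`). So, if two closed walks with `k` and `l` steps
are correlated, every vertex is visited at least twice by the two together, and there are at most
`(k + l) / 2` vertices. In the case of equality every vertex is visited exactly twice; a vertex
common to both walks is then visited once by each of them, so the edge leaving it is shared and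
leads to another common vertex. Walks without a common vertex being independent, both walks
are thus simple cycles through the same vertices
(`IsWignerOfParameter.card_lt_or_injective`). All other pairs are too few to matter after
normalization.

For a fixed simple cycle the correlated partners are its rotations and reflections, and independence
gives their total contribution `k (2 / β) c ^ k`
(`IsWignerOfParameter.sum_walkCov_of_injective`). Counting simple cycles in `B_p ∩ B_q` gives the
limit when each matrix is scaled by its exact size
(`IsWignerOfParameter.tendsto_covariance_card`). Finally `T_k(r x)` is a combination of Chebyshev
polynomials whose coefficients are continuous in `r`, so that the exact size may be replaced by
`b_p L` (`IsWignerOfParameter.tendsto_covariance`).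
-/

/-! ### Signed weights of walks -/

section PathWeight

variable {V R : Type*} [DecidableEq V] [CommRing R]

/-- The weight of the walk `u 0, …, u j`: the product of the entries of `X` along its steps, summed
with sign over the ways of cancelling disjoint pairs of consecutive steps that form a backtrack
`a → b → a`; a cancelled pair contributes `-1` in place of its two entries. It satisfies the
three-term recursion of the Chebyshev polynomials, with the walk kept fixed. -/
def pathWeight (X : Matrix V V R) (u : ℕ → V) : ℕ → R
  | 0 => 1
  | 1 => X (u 0) (u 1)
  | j + 2 => pathWeight X u (j + 1) * X (u (j + 1)) (u (j + 2))
      - if u j = u (j + 2) then pathWeight X u j else 0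

theorem pathWeight_congr (X : Matrix V V R) {u v : ℕ → V} :
    ∀ j, (∀ i ≤ j, u i = v i) → pathWeight X u j = pathWeight X v j
  | 0, _ => rfl
  | 1, h => by simp [pathWeight, h]
  | j + 2, h => by
    rw [pathWeight, pathWeight, pathWeight_congr X (j + 1) fun i hi => h i (by omega),
      pathWeight_congr X j fun i hi => h i (by omega), h j (by omega), h (j + 1) (by omega),
      h (j + 2) le_rfl]

/-- The three-term recursion at the initial end of the walk. -/
theorem pathWeight_add_two_left (X : Matrix V V R) (u : ℕ → V) :
    ∀ j, pathWeight X u (j + 2) = X (u 0) (u 1) * pathWeight X (fun i => u (i + 1)) (j + 1)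
      - if u 0 = u 2 then pathWeight X (fun i => u (i + 2)) j else 0
  | 0 => by simp [pathWeight]
  | 1 => by
    simp only [pathWeight]
    split_ifs <;> ring
  | j + 2 => by
    rw [pathWeight, pathWeight_add_two_left X u (j + 1), pathWeight_add_two_left X u j,
      pathWeight.eq_3 X (fun i => u (i + 1)) (j + 1), pathWeight.eq_3 X (fun i => u (i + 2)) j]
    split_ifs <;> ring

/-- The weight of the closed walk with `k` steps given by the first `k` values of a function `u` of
period `k`: as for `pathWeight`, with the backtracks taken along the cycle, so that the last step
may be cancelled against the first. For `k = 2` either of the two pairs can be cancelled, and the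
weight is `X a b * X b a - 2`. The value at `k = 0` is a convention. -/
def cycleWeight (X : Matrix V V R) (u : ℕ → V) : ℕ → R
  | 0 => 0
  | 1 => X (u 0) (u 1)
  | k + 2 => pathWeight X u (k + 2)
      - if u (k + 1) = u (k + 3) then pathWeight X (fun i => u (i + 1)) k else 0

theorem cycleWeight_shift (X : Matrix V V R) (u : ℕ → V) (k : ℕ) (hu : ∀ i, u (i + k) = u i) :
    cycleWeight X (fun i => u (i + 1)) k = cycleWeight X u k := by
  have h0 : u k = u 0 := by simpa using hu 0
  have h1 : u (k + 1) = u 1 := by simpa [add_comm] using hu 1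
  have h2 : u (k + 2) = u 2 := by simpa [add_comm] using hu 2
  match k with
  | 0 => rfl
  | 1 => simp only [cycleWeight]; simp [h0, h1]
  | k + 2 =>
    rw [cycleWeight, cycleWeight, pathWeight_add_two_left X u k, pathWeight]
    simp only [add_assoc, Nat.reduceAdd] at h0 h1 h2 ⊢
    rw [h0, h1, h2]
    split_ifs <;> ring

/-- If the last vertex of a closed walk with at least three steps is visited only once, then only
its two adjacent steps can be cancelled against each other, and the weight factors. -/
theorem cycleWeight_eq_mul (X : Matrix V V R) (u : ℕ → V) (k : ℕ) (hk : u (k + 3) = u 0)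
    (h1 : u (k + 4) = u 1) (h : ∀ i < k + 2, u i ≠ u (k + 2)) :
    cycleWeight X u (k + 3) = (X (u (k + 1)) (u (k + 2)) * X (u (k + 2)) (u 0)
      - if u (k + 1) = u 0 then 1 else 0) * pathWeight X u (k + 1) := by
  rw [cycleWeight, pathWeight, pathWeight]
  simp only [add_assoc, Nat.reduceAdd]
  rw [hk, h1, if_neg (h k (by omega)), if_neg (Ne.symm (h 1 (by omega)))]
  split_ifs <;> ring

/-- Without backtracks nothing can be cancelled. -/
theorem pathWeight_eq_prod (X : Matrix V V R) (u : ℕ → V) :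
    ∀ j, (∀ i, i + 2 ≤ j → u i ≠ u (i + 2)) →
      pathWeight X u j = ∏ i ∈ Finset.range j, X (u i) (u (i + 1))
  | 0, _ => by simp [pathWeight]
  | 1, _ => by simp [pathWeight]
  | j + 2, h => by
    rw [pathWeight, if_neg (h j le_rfl), pathWeight_eq_prod X u (j + 1) fun i hi => h i (by omega),
      Finset.prod_range_succ _ (j + 1), sub_zero]

end PathWeight

/-! ### Summation over walks in a finite set -/

section Tuple

variable {V R : Type*} [AddCommMonoid R]

/-- The sequence of period `k` whose first `k` values are given by `w`. -/
def periodize {k : ℕ} [NeZero k] (w : Fin k → V) (i : ℕ) : V := w (Fin.ofNat k i)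

theorem periodize_snoc_of_le {j : ℕ} (w : Fin (j + 1) → V) (x : V) {i : ℕ} (hi : i ≤ j) :
    periodize (Fin.snoc w x : Fin (j + 2) → V) i = periodize w i := by
  have h1 : Fin.ofNat (j + 2) i = Fin.castSucc (Fin.ofNat (j + 1) i) := by
    ext
    simp [Fin.ofNat, Nat.mod_eq_of_lt (show i < j + 1 by omega),
      Nat.mod_eq_of_lt (show i < j + 2 by omega)]
  rw [periodize, h1, Fin.snoc_castSucc, periodize]

theorem periodize_snoc_last {j : ℕ} (w : Fin (j + 1) → V) (x : V) :
    periodize (Fin.snoc w x : Fin (j + 2) → V) (j + 1) = x := by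
  have h1 : Fin.ofNat (j + 2) (j + 1) = Fin.last (j + 1) := by
    ext
    simp [Fin.ofNat]
  rw [periodize, h1, Fin.snoc_last]

theorem periodize_cons_succ {j : ℕ} (w : Fin (j + 1) → V) (x : V) {i : ℕ} (hi : i ≤ j) :
    periodize (Fin.cons x w : Fin (j + 2) → V) (i + 1) = periodize w i := by
  have h1 : Fin.ofNat (j + 2) (i + 1) = Fin.succ (Fin.ofNat (j + 1) i) := by
    ext
    simp [Fin.ofNat, Nat.mod_eq_of_lt (show i < j + 1 by omega),
      Nat.mod_eq_of_lt (show i + 1 < j + 2 by omega)]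
  rw [periodize, h1, Fin.cons_succ, periodize]

theorem periodize_add {k : ℕ} [NeZero k] (w : Fin k → V) (i : ℕ) :
    periodize w (i + k) = periodize w i := by
  simp [periodize, Fin.ofNat]

theorem sum_tuple_snoc [Fintype V] {j : ℕ} (F : (Fin (j + 1) → V) → R) :
    ∑ w, F w = ∑ w : Fin j → V, ∑ x, F (Fin.snoc w x) := by
  rw [← (Fin.snocEquiv fun _ : Fin (j + 1) => V).sum_comp, Fintype.sum_prod_type, Finset.sum_comm]
  rfl

theorem sum_tuple_cons [Fintype V] {j : ℕ} (F : (Fin (j + 1) → V) → R) :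
    ∑ w, F w = ∑ w : Fin j → V, ∑ x, F (Fin.cons x w) := by
  rw [← (Fin.consEquiv fun _ : Fin (j + 1) => V).sum_comp, Fintype.sum_prod_type, Finset.sum_comm]
  rfl

end Tuple

section Trace

variable {V R : Type*} [DecidableEq V] [CommRing R] [Fintype V]

/-- The matrix polynomials `N ^ (j / 2) U_j(X / (2 √N))` with `N` the size of the matrix `X`, given
by their recursion. -/
def walkMatrix (X : Matrix V V R) : ℕ → Matrix V V R
  | 0 => 1
  | 1 => X
  | j + 2 => walkMatrix X (j + 1) * X - (Fintype.card V : R) • walkMatrix X j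

/-- The path weights of walks with `j` steps sum to the entries of `walkMatrix X j`; the matrix `Q`
tests the two end points. -/
theorem sum_pathWeight_mul (X : Matrix V V R) :
    ∀ (j : ℕ) (Q : Matrix V V R), ∑ w : Fin (j + 1) → V,
      pathWeight X (periodize w) j * Q (periodize w j) (periodize w 0)
        = (walkMatrix X j * Q).trace
  | 0, Q => by
    rw [sum_tuple_cons, Fintype.sum_unique]
    simp only [pathWeight, walkMatrix, one_mul, Matrix.trace, Matrix.diag]
    rfl
  | 1, Q => by
    rw [sum_tuple_snoc, sum_tuple_cons, Fintype.sum_unique]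
    simp only [pathWeight, walkMatrix, Matrix.trace, Matrix.diag, Matrix.mul_apply]
    rfl
  | j + 2, Q => by
    have h1 : ∀ w : Fin (j + 2) → V, ∑ x, pathWeight X (periodize w) (j + 1)
          * X (periodize w (j + 1)) x * Q x (periodize w 0)
        = pathWeight X (periodize w) (j + 1) * (X * Q) (periodize w (j + 1)) (periodize w 0) := by
      intro w
      simp only [mul_assoc, Matrix.mul_apply, Finset.mul_sum]
    have h2 : ∀ w : Fin (j + 1) → V, ∑ y : V, ∑ x, (if periodize w j = x
          then pathWeight X (periodize w) j else 0) * Q x (periodize w 0)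
        = (Fintype.card V : R) * (pathWeight X (periodize w) j
          * Q (periodize w j) (periodize w 0)) := by
      intro w
      simp [ite_mul, Finset.sum_const]
    rw [walkMatrix, sub_mul, Matrix.trace_sub, mul_assoc, ← sum_pathWeight_mul X (j + 1) (X * Q),
      Matrix.smul_mul, Matrix.trace_smul, ← sum_pathWeight_mul X j Q, smul_eq_mul, Finset.mul_sum]
    simp_rw [← h1, ← h2]
    rw [sum_tuple_snoc (j := j + 2)]
    simp only [pathWeight, sub_mul, Finset.sum_sub_distrib]
    congr 1
    · refine Finset.sum_congr rfl fun w _ => Finset.sum_congr rfl fun x _ => ?_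
      rw [periodize_snoc_last, periodize_snoc_of_le w x le_rfl,
        periodize_snoc_of_le w x (Nat.zero_le _),
        pathWeight_congr X (j + 1) fun i hi => periodize_snoc_of_le w x hi]
    · rw [sum_tuple_snoc (j := j + 1)]
      refine Finset.sum_congr rfl fun w _ => Finset.sum_congr rfl fun y _ =>
        Finset.sum_congr rfl fun x _ => ?_
      have h3 : ∀ i ≤ j, periodize (Fin.snoc (Fin.snoc w y : Fin (j + 2) → V) x : Fin (j + 3) → V) i
          = periodize w i := fun i hi => by
        rw [periodize_snoc_of_le _ _ (by omega), periodize_snoc_of_le _ _ hi]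
      rw [periodize_snoc_last, h3 j le_rfl, h3 0 (Nat.zero_le _), pathWeight_congr X j h3]

theorem sum_cycleWeight_add_two (X : Matrix V V R) (k : ℕ) :
    ∑ w : Fin (k + 2) → V, cycleWeight X (periodize w) (k + 2)
      = (walkMatrix X (k + 2)).trace - Fintype.card V * (walkMatrix X k).trace := by
  have h0 : ∀ w : Fin (k + 2) → V, periodize w (k + 2) = periodize w 0 := fun w => by
    simpa using periodize_add w 0
  have h1 : ∀ w : Fin (k + 2) → V, periodize w (k + 3) = periodize w 1 := fun w => by
    simpa [add_comm, add_left_comm] using periodize_add w 1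
  simp only [cycleWeight, pathWeight, Finset.sum_sub_distrib, h0, h1]
  rw [sum_pathWeight_mul X (k + 1) X, walkMatrix, Matrix.trace_sub, Matrix.trace_smul, smul_eq_mul]
  congr 1
  · congr 1
    rw [sum_tuple_snoc, ← mul_one (walkMatrix X k), ← sum_pathWeight_mul X k 1, Finset.mul_sum]
    refine Finset.sum_congr rfl fun w _ => ?_
    rw [Finset.sum_congr rfl fun x _ => by
      rw [periodize_snoc_of_le w x le_rfl, periodize_snoc_of_le w x (Nat.zero_le _),
        pathWeight_congr X k fun i hi => periodize_snoc_of_le w x hi]]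
    simp [Matrix.one_apply]
  · rw [sum_tuple_cons, ← mul_one (walkMatrix X k), ← sum_pathWeight_mul X k 1, Finset.mul_sum]
    refine Finset.sum_congr rfl fun w _ => ?_
    rw [Finset.sum_congr rfl fun x _ => by
      rw [periodize_cons_succ w x le_rfl,
        show periodize (Fin.cons x w : Fin (k + 2) → V) 1 = periodize w 0 from
          periodize_cons_succ w x (Nat.zero_le k),
        pathWeight_congr X k fun i hi => periodize_cons_succ w x hi]]
    simp [Matrix.one_apply]

theorem sum_cycleWeight_one (X : Matrix V V R) :
    ∑ w : Fin 1 → V, cycleWeight X (periodize w) 1 = X.trace := by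
  rw [sum_tuple_cons, Fintype.sum_unique]
  rfl

end Trace

/-! ### Chebyshev polynomials of a matrix -/

section Chebyshev

open Polynomial

variable {V 𝕜 : Type*} [DecidableEq V] [Fintype V] [RCLike 𝕜]

theorem two_mul_X_comp_rescale {s : ℝ} (hs : s ≠ 0) :
    (2 * X : ℝ[X]).comp (C (2 * s)⁻¹ * X) = C s⁻¹ * X := by
  rw [show (2 : ℝ[X]) = C 2 from (map_ofNat C 2).symm, mul_comp, X_comp, C_comp, ← mul_assoc,
    ← C_mul]
  congr 2
  field_simp

theorem walkMatrix_eq_aeval [Nonempty V] (M : Matrix V V 𝕜) :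
    ∀ j : ℕ, walkMatrix M j = √(Fintype.card V : ℝ) ^ j •
      aeval M ((Chebyshev.U ℝ j).comp (C (2 * √(Fintype.card V : ℝ))⁻¹ * X))
  | 0 => by simp [walkMatrix]
  | 1 => by
    have h : √(Fintype.card V : ℝ) ≠ 0 := by positivity
    rw [Nat.cast_one, Chebyshev.U_one, two_mul_X_comp_rescale h, map_mul, aeval_C, aeval_X, pow_one,
      ← Algebra.smul_def, smul_smul, mul_inv_cancel₀ h, one_smul]
    rfl
  | j + 2 => by
    have h : √(Fintype.card V : ℝ) ≠ 0 := by positivity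
    have h2 : √(Fintype.card V : ℝ) ^ 2 = Fintype.card V := Real.sq_sqrt (Nat.cast_nonneg _)
    have h3 (A : Matrix V V 𝕜) : (Fintype.card V : 𝕜) • A = (√(Fintype.card V : ℝ) ^ 2) • A := by
      rw [h2, Nat.cast_smul_eq_nsmul, Nat.cast_smul_eq_nsmul]
    have h4 : (Chebyshev.U ℝ ((j + 2 : ℕ) : ℤ)) = Chebyshev.U ℝ ((j + 1 : ℕ) : ℤ)
        * (2 * X) - Chebyshev.U ℝ (j : ℤ) := by
      push_cast
      rw [mul_comm]
      exact Chebyshev.U_add_two ℝ j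
    rw [walkMatrix, walkMatrix_eq_aeval M (j + 1), walkMatrix_eq_aeval M j, h4, sub_comp,
      mul_comp _ (2 * X), two_mul_X_comp_rescale h, map_sub, map_mul, map_mul, aeval_C, aeval_X,
      ← Algebra.smul_def, h3, smul_smul, ← pow_add, smul_sub, mul_smul_comm, smul_smul,
      smul_mul_assoc, add_comm 2 j, pow_succ _ (j + 1), mul_assoc, mul_inv_cancel₀ h, mul_one]

/-- The weights of the closed walks with `k` steps sum to a Chebyshev trace. -/
theorem sum_cycleWeight_eq_trace [Nonempty V] (M : Matrix V V 𝕜) (k : ℕ) :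
    ∑ w : Fin (k + 1) → V, cycleWeight M (periodize w) (k + 1)
      = (2 * √(Fintype.card V : ℝ) ^ (k + 1)) •
        (aeval M (rescaledChebyshev (k + 1) (2 * √(Fintype.card V : ℝ)))).trace := by
  have h : √(Fintype.card V : ℝ) ≠ 0 := by positivity
  have h2 : √(Fintype.card V : ℝ) ^ 2 = Fintype.card V := Real.sq_sqrt (Nat.cast_nonneg _)
  have key (p : ℝ[X]) (n : ℕ) : (2 * √(Fintype.card V : ℝ) ^ n) • (aeval M
      (p.comp (C (2 * √(Fintype.card V : ℝ))⁻¹ * X))).trace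
      = √(Fintype.card V : ℝ) ^ n • (aeval M
        ((2 * p).comp (C (2 * √(Fintype.card V : ℝ))⁻¹ * X))).trace := by
    rw [show (2 : ℝ[X]) = C 2 from (map_ofNat C 2).symm, mul_comp, C_comp, mul_comm 2, mul_smul,
      ← smul_eq_C_mul 2, map_smul, Matrix.trace_smul]
  rw [rescaledChebyshev, key]
  cases k with
  | zero =>
    rw [sum_cycleWeight_one, zero_add, Nat.cast_one, Chebyshev.T_one, two_mul_X_comp_rescale h,
      map_mul, aeval_C, aeval_X, ← Algebra.smul_def, Matrix.trace_smul, smul_smul, pow_one,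
      mul_inv_cancel₀ h, one_smul]
  | succ k =>
    rw [sum_cycleWeight_add_two, walkMatrix_eq_aeval, walkMatrix_eq_aeval, Matrix.trace_smul,
      Matrix.trace_smul, show (((k + 1 + 1 : ℕ) : ℤ)) = (k : ℤ) + 2 by push_cast; ring,
      Chebyshev.two_mul_T_eq_U_sub_U, sub_comp, map_sub, Matrix.trace_sub, smul_sub]
    rw [← nsmul_eq_mul, ← Nat.cast_smul_eq_nsmul ℝ (Fintype.card V), smul_smul,
      show (Fintype.card V : ℝ) * √(Fintype.card V : ℝ) ^ k = √(Fintype.card V : ℝ) ^ (k + 1 + 1) by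
        rw [pow_succ, pow_succ, mul_assoc, ← sq, h2, mul_comm]]

end Chebyshev

/-! ### Random variables with moments of all orders -/

section Moments

variable {Ω 𝕜 ι κ : Type*} [MeasurableSpace Ω] [RCLike 𝕜] {P : Measure Ω}

/-- A family of random variables whose absolute moments of every order are finite, with a bound
uniform over the family. -/
def HasUniformMoments (P : Measure Ω) (f : ι → Ω → 𝕜) : Prop :=
  (∀ i, AEStronglyMeasurable (f i) P) ∧ ∀ n : ℕ, ∃ C : ℝ, ∀ i,
    Integrable (fun ω => ‖f i ω‖ ^ n) P ∧ ∫ ω, ‖f i ω‖ ^ n ∂P ≤ C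

namespace HasUniformMoments

variable {f g : ι → Ω → 𝕜}

theorem comp (hf : HasUniformMoments P f) (φ : κ → ι) : HasUniformMoments P fun i => f (φ i) :=
  ⟨fun i => hf.1 (φ i), fun n => (hf.2 n).imp fun _ hC i => hC (φ i)⟩

theorem const [IsProbabilityMeasure P] (c : ι → 𝕜) {K : ℝ} (hc : ∀ i, ‖c i‖ ≤ K) :
    HasUniformMoments P fun i (_ : Ω) => c i :=
  ⟨fun _ => aestronglyMeasurable_const, fun n => ⟨K ^ n, fun i => ⟨integrable_const _, by
    simpa using pow_le_pow_left₀ (norm_nonneg _) (hc i) n⟩⟩⟩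

theorem mul (hf : HasUniformMoments P f) (hg : HasUniformMoments P g) :
    HasUniformMoments P fun i ω => f i ω * g i ω := by
  refine ⟨fun i => (hf.1 i).mul (hg.1 i), fun n => ?_⟩
  obtain ⟨C, hC⟩ := hf.2 (2 * n)
  obtain ⟨D, hD⟩ := hg.2 (2 * n)
  refine ⟨C + D, fun i => ?_⟩
  have hle : ∀ ω, ‖f i ω * g i ω‖ ^ n ≤ ‖f i ω‖ ^ (2 * n) + ‖g i ω‖ ^ (2 * n) := fun ω => by
    rw [norm_mul, mul_pow, mul_comm 2 n, pow_mul, pow_mul]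
    nlinarith [sq_nonneg (‖f i ω‖ ^ n - ‖g i ω‖ ^ n), sq_nonneg (‖f i ω‖ ^ n),
      sq_nonneg (‖g i ω‖ ^ n)]
  have hint : Integrable (fun ω => ‖f i ω‖ ^ (2 * n) + ‖g i ω‖ ^ (2 * n)) P :=
    (hC i).1.add (hD i).1
  have hfg : Integrable (fun ω => ‖f i ω * g i ω‖ ^ n) P :=
    hint.mono' (((hf.1 i).mul (hg.1 i)).norm.pow n) (ae_of_all _ fun ω => by
      simpa using hle ω)
  refine ⟨hfg, (integral_mono hfg hint hle).trans ?_⟩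
  rw [integral_add (hC i).1 (hD i).1]
  exact add_le_add (hC i).2 (hD i).2

theorem sub (hf : HasUniformMoments P f) (hg : HasUniformMoments P g) :
    HasUniformMoments P fun i ω => f i ω - g i ω := by
  refine ⟨fun i => (hf.1 i).sub (hg.1 i), fun n => ?_⟩
  obtain ⟨C, hC⟩ := hf.2 n
  obtain ⟨D, hD⟩ := hg.2 n
  refine ⟨2 ^ (n - 1) * (C + D), fun i => ?_⟩
  have hle : ∀ ω, ‖f i ω - g i ω‖ ^ n ≤ 2 ^ (n - 1) * (‖f i ω‖ ^ n + ‖g i ω‖ ^ n) := fun ω =>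
    (pow_le_pow_left₀ (norm_nonneg _) (norm_sub_le _ _) n).trans
      (add_pow_le (norm_nonneg _) (norm_nonneg _) n)
  have hint : Integrable (fun ω => 2 ^ (n - 1) * (‖f i ω‖ ^ n + ‖g i ω‖ ^ n)) P :=
    ((hC i).1.add (hD i).1).const_mul _
  have hfg : Integrable (fun ω => ‖f i ω - g i ω‖ ^ n) P :=
    hint.mono' (((hf.1 i).sub (hg.1 i)).norm.pow n) (ae_of_all _ fun ω => by
      simpa using hle ω)
  refine ⟨hfg, (integral_mono hfg hint hle).trans ?_⟩
  rw [integral_const_mul, integral_add (hC i).1 (hD i).1]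
  exact mul_le_mul_of_nonneg_left (add_le_add (hC i).2 (hD i).2) (by positivity)

theorem ite [IsProbabilityMeasure P] (hf : HasUniformMoments P f) (p : ι → Prop)
    [∀ i, Decidable (p i)] : HasUniformMoments P fun i ω => if p i then f i ω else 0 := by
  have h := (const (P := P) (fun i => if p i then (1 : 𝕜) else 0) (K := 1) fun i => by
    split_ifs <;> simp).mul hf
  simpa only [ite_mul, one_mul, zero_mul] using h

theorem integrable (hf : HasUniformMoments P f) (i : ι) : Integrable (f i) P := by
  obtain ⟨C, hC⟩ := hf.2 1
  have h := (hC i).1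
  simp only [pow_one] at h
  exact (integrable_norm_iff (hf.1 i)).1 h

theorem memLp_two (hf : HasUniformMoments P f) (i : ι) : MemLp (f i) 2 P := by
  obtain ⟨C, hC⟩ := hf.2 2
  exact (memLp_two_iff_integrable_sq_norm (hf.1 i)).2 (hC i).1

theorem norm_integral_le (hf : HasUniformMoments P f) : ∃ C, ∀ i, ‖∫ ω, f i ω ∂P‖ ≤ C := by
  obtain ⟨C, hC⟩ := hf.2 1
  refine ⟨C, fun i => (norm_integral_le_integral_norm _).trans ?_⟩
  simpa using (hC i).2

end HasUniformMoments

/-- The covariance `E[f g] - E[f] E[g]`, without complex conjugation, so that it is bilinear for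
complex random variables too. -/
noncomputable def bilinCov (P : Measure Ω) (f g : Ω → 𝕜) : 𝕜 :=
  ∫ ω, f ω * g ω ∂P - (∫ ω, f ω ∂P) * ∫ ω, g ω ∂P

theorem bilinCov_comm (f g : Ω → 𝕜) : bilinCov P f g = bilinCov P g f := by
  simp only [bilinCov, mul_comm]

theorem bilinCov_const_mul (a b : 𝕜) (f g : Ω → 𝕜) :
    bilinCov P (fun ω => a * f ω) (fun ω => b * g ω) = a * b * bilinCov P f g := by
  have h : ∀ ω, a * f ω * (b * g ω) = a * b * (f ω * g ω) := fun ω => by ring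
  simp only [bilinCov, h, integral_const_mul]
  ring

theorem bilinCov_sum_sum {s : Finset ι} {t : Finset κ} {f : ι → Ω → 𝕜} {g : κ → Ω → 𝕜}
    (hf : HasUniformMoments P f) (hg : HasUniformMoments P g) :
    bilinCov P (fun ω => ∑ i ∈ s, f i ω) (fun ω => ∑ j ∈ t, g j ω)
      = ∑ i ∈ s, ∑ j ∈ t, bilinCov P (f i) (g j) := by
  have hfg := (hf.comp (Prod.fst : ι × κ → ι)).mul (hg.comp (Prod.snd : ι × κ → κ))
  simp only [bilinCov, Finset.sum_sub_distrib, Finset.sum_mul_sum]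
  rw [integral_finsetSum _ fun i _ => hf.integrable i,
    integral_finsetSum _ fun i _ => hg.integrable i, Finset.sum_mul_sum,
    integral_finsetSum _ fun i _ => integrable_finsetSum _ fun j _ => hfg.integrable (i, j)]
  congr 1
  exact Finset.sum_congr rfl fun i _ => integral_finsetSum _ fun j _ => hfg.integrable (i, j)

theorem exists_norm_bilinCov_le {f : ι → Ω → 𝕜} {g : κ → Ω → 𝕜}
    (hf : HasUniformMoments P f) (hg : HasUniformMoments P g) :
    ∃ C, ∀ i j, ‖bilinCov P (f i) (g j)‖ ≤ C := by
  obtain ⟨C, hC⟩ :=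
    ((hf.comp (Prod.fst : ι × κ → ι)).mul (hg.comp (Prod.snd : ι × κ → κ))).norm_integral_le
  obtain ⟨D, hD⟩ := hf.norm_integral_le
  obtain ⟨E, hE⟩ := hg.norm_integral_le
  refine ⟨C + D * E, fun i j => (norm_sub_le _ _).trans (add_le_add (hC (i, j)) ?_)⟩
  rw [norm_mul]
  exact mul_le_mul (hD i) (hE j) (norm_nonneg _) ((norm_nonneg _).trans (hD i))

theorem ofReal_covariance_eq_bilinCov [IsProbabilityMeasure P] {f g : Ω → ℝ} (hf : MemLp f 2 P)
    (hg : MemLp g 2 P) :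
    ((cov[f, g; P] : ℝ) : 𝕜) = bilinCov P (fun ω => (f ω : 𝕜)) fun ω => (g ω : 𝕜) := by
  rw [covariance_eq_sub hf hg, bilinCov, integral_ofReal, integral_ofReal]
  simp_rw [← RCLike.ofReal_mul]
  rw [integral_ofReal]
  simp

end Moments

theorem measurable_comap_apply {Ω τ E : Type*} [MeasurableSpace E] (t : τ) (p : Ω → τ → E) :
    Measurable[MeasurableSpace.comap p MeasurableSpace.pi] fun ω => p ω t :=
  (measurable_pi_apply t).comp (comap_measurable p)

/-! ### Independence of the matrix entries -/

section Entries

variable {Ω 𝕜 : Type*} [RCLike 𝕜]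

/-- The label of the independent process that determines the entries `(a, b)` and `(b, a)`. -/
def entryLabel (a b : ℕ+) : ℕ+ ⊕ UpperPair :=
  if h : a < b then .inr ⟨(a, b), h⟩ else if h' : b < a then .inr ⟨(b, a), h'⟩ else .inl a

theorem entryLabel_of_lt {a b : ℕ+} (h : a < b) : entryLabel a b = .inr ⟨(a, b), h⟩ := dif_pos h

theorem entryLabel_of_gt {a b : ℕ+} (h : b < a) : entryLabel a b = .inr ⟨(b, a), h⟩ := by
  rw [entryLabel, dif_neg (not_lt_of_gt h), dif_pos h]

theorem entryLabel_self (a : ℕ+) : entryLabel a a = .inl a := by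
  simp [entryLabel]

theorem entryLabel_eq_iff {a b c d : ℕ+} :
    entryLabel a b = entryLabel c d ↔ (a = c ∧ b = d) ∨ (a = d ∧ b = c) := by
  rcases lt_trichotomy a b with h | rfl | h <;> rcases lt_trichotomy c d with h' | rfl | h' <;>
    simp only [entryLabel_of_lt, entryLabel_of_gt, entryLabel_self, *, Sum.inr.injEq, Sum.inl.injEq,
      Subtype.mk.injEq, Prod.mk.injEq, reduceCtorEq, false_iff] <;> grind

theorem entryLabel_comm (a b : ℕ+) : entryLabel a b = entryLabel b a :=
  entryLabel_eq_iff.2 (Or.inr ⟨rfl, rfl⟩)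

variable [MeasurableSpace 𝕜] (Y : ℕ+ → ℝ → Ω → ℝ) (Z : UpperPair → ℝ → Ω → 𝕜)

/-- The sigma-algebra generated by the processes with labels in `S`. -/
abbrev entrySigma (S : Set (ℕ+ ⊕ UpperPair)) : MeasurableSpace Ω :=
  ⨆ e ∈ S, Sum.elim
    (fun i : ℕ+ => MeasurableSpace.comap (fun (ω : Ω) (t : ℝ) => Y i t ω) MeasurableSpace.pi)
    (fun e : UpperPair =>
      MeasurableSpace.comap (fun (ω : Ω) (t : ℝ) => Z e t ω) MeasurableSpace.pi) e

variable {Y Z}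

theorem measurable_wignerMatrix_entrySigma [BorelSpace 𝕜] {S : Set (ℕ+ ⊕ UpperPair)} {a b : ℕ+}
    (h : entryLabel a b ∈ S) (t : ℝ) :
    Measurable[entrySigma Y Z S] fun ω => wignerMatrix Y Z t ω a b := by
  refine Measurable.mono ?_ (le_iSup₂ (f := fun e (_ : e ∈ S) => Sum.elim
    (fun i : ℕ+ => MeasurableSpace.comap (fun (ω : Ω) (t : ℝ) => Y i t ω) MeasurableSpace.pi)
    (fun e : UpperPair =>
      MeasurableSpace.comap (fun (ω : Ω) (t : ℝ) => Z e t ω) MeasurableSpace.pi) e) _ h) le_rfl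
  rcases lt_trichotomy a b with h | rfl | h
  · rw [entryLabel_of_lt h]
    simp only [wignerMatrix, h, dite_true]
    exact measurable_comap_apply t (fun ω t => Z ⟨(a, b), h⟩ t ω)
  · rw [entryLabel_self]
    simp only [wignerMatrix, lt_irrefl, dite_false]
    exact RCLike.continuous_ofReal.measurable.comp (measurable_comap_apply t fun ω t => Y a t ω)
  · rw [entryLabel_of_gt h]
    simp only [wignerMatrix, h, not_lt_of_gt h, dite_true, dite_false]
    exact continuous_star.measurable.comp (measurable_comap_apply t fun ω t => Z ⟨(b, a), h⟩ t ω)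

variable [MeasurableSpace Ω] {P : Measure Ω}

namespace IsWignerFamily

variable (hW : IsWignerFamily P Y Z)
include hW

theorem entrySigma_le (S : Set (ℕ+ ⊕ UpperPair)) : entrySigma Y Z S ≤ ‹MeasurableSpace Ω› := by
  refine iSup₂_le fun e _ => ?_
  rcases e with i | e
  · exact (measurable_pi_lambda _ fun t => hW.measurable_diag i t).comap_le
  · exact (measurable_pi_lambda _ fun t => hW.measurable_off e t).comap_le

theorem integral_mul_of_disjoint [BorelSpace 𝕜] {S T : Set (ℕ+ ⊕ UpperPair)} (hST : Disjoint S T)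
    {f g : Ω → 𝕜} (hf : Measurable[entrySigma Y Z S] f) (hg : Measurable[entrySigma Y Z T] g) :
    ∫ ω, f ω * g ω ∂P = (∫ ω, f ω ∂P) * ∫ ω, g ω ∂P := by
  have hind : Indep (entrySigma Y Z S) (entrySigma Y Z T) P := by
    refine indep_iSup_of_disjoint (fun e => ?_) hW.indep hST
    rcases e with i | e
    · exact (measurable_pi_lambda _ fun t => hW.measurable_diag i t).comap_le
    · exact (measurable_pi_lambda _ fun t => hW.measurable_off e t).comap_le
  have hfg : IndepFun f g P := by
    rw [IndepFun_iff_Indep]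
    exact indep_of_indep_of_le_right (indep_of_indep_of_le_left hind hf.comap_le) hg.comap_le
  rw [BorelSpace.measurable_eq (α := 𝕜)] at hfg
  exact IndepFun.integral_fun_mul_eq_mul_integral hfg
    (hf.mono (hW.entrySigma_le S) le_rfl).aestronglyMeasurable
    (hg.mono (hW.entrySigma_le T) le_rfl).aestronglyMeasurable

theorem bilinCov_eq_zero_of_disjoint [BorelSpace 𝕜] {S T : Set (ℕ+ ⊕ UpperPair)}
    (hST : Disjoint S T) {f g : Ω → 𝕜} (hf : Measurable[entrySigma Y Z S] f)
    (hg : Measurable[entrySigma Y Z T] g) : bilinCov P f g = 0 :=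
  sub_eq_zero.2 (hW.integral_mul_of_disjoint hST hf hg)

theorem measurable_wignerMatrix [BorelSpace 𝕜] (t : ℝ) (a b : ℕ+) :
    Measurable fun ω => wignerMatrix Y Z t ω a b :=
  (measurable_wignerMatrix_entrySigma (Set.mem_univ _) t).mono
    (hW.entrySigma_le Set.univ) le_rfl

/-- Expectations of entries above the diagonal do not depend on the position. -/
theorem integral_off_eq {E : Type*} [NormedAddCommGroup E] [NormedSpace ℝ E] [MeasurableSpace E]
    [BorelSpace E] (e : UpperPair) {F : (ℝ → 𝕜) → E} (hF : Measurable F) :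
    ∫ ω, F (fun t => Z e t ω) ∂P = ∫ ω, F (fun t => Z pairOneTwo t ω) ∂P :=
  ((hW.identDistrib_off e).comp hF).integral_eq

theorem integral_diag_eq {E : Type*} [NormedAddCommGroup E] [NormedSpace ℝ E] [MeasurableSpace E]
    [BorelSpace E] (i : ℕ+) {F : (ℝ → ℝ) → E} (hF : Measurable F) :
    ∫ ω, F (fun t => Y i t ω) ∂P = ∫ ω, F (fun t => Y 1 t ω) ∂P :=
  ((hW.identDistrib_diag i).comp hF).integral_eq

theorem hasUniformMoments_wignerMatrix [BorelSpace 𝕜] [IsProbabilityMeasure P] (t : ℝ) :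
    HasUniformMoments P fun (e : ℕ+ × ℕ+) ω => wignerMatrix Y Z t ω e.1 e.2 := by
  refine ⟨fun e => (hW.measurable_wignerMatrix t e.1 e.2).aestronglyMeasurable, fun n => ?_⟩
  rcases Nat.eq_zero_or_pos n with rfl | hn
  · exact ⟨1, fun e => by simp⟩
  obtain ⟨C, hC⟩ := hW.moment_diag n hn
  obtain ⟨D, hD⟩ := hW.moment_off n hn
  have hoff : ∀ e, Integrable (fun ω => ‖Z e t ω‖ ^ n) P ∧ ∫ ω, ‖Z e t ω‖ ^ n ∂P ≤ max C D := by
    intro e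
    have hm : Measurable fun z : ℝ → 𝕜 => ‖z t‖ ^ n := by fun_prop
    exact ⟨((hW.identDistrib_off e).comp hm).integrable_iff.2 (hD t).1,
      ((hW.integral_off_eq e hm).trans_le (hD t).2).trans (le_max_right _ _)⟩
  have hdiag : ∀ i, Integrable (fun ω => |Y i t ω| ^ n) P ∧ ∫ ω, |Y i t ω| ^ n ∂P ≤ max C D := by
    intro i
    have hm : Measurable fun z : ℝ → ℝ => |z t| ^ n := by fun_prop
    exact ⟨((hW.identDistrib_diag i).comp hm).integrable_iff.2 (hC t).1,
      ((hW.integral_diag_eq i hm).trans_le (hC t).2).trans (le_max_left _ _)⟩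
  refine ⟨max C D, fun ⟨a, b⟩ => ?_⟩
  rcases lt_trichotomy a b with h | rfl | h
  · simpa [wignerMatrix, h] using hoff ⟨(a, b), h⟩
  · simpa [wignerMatrix] using hdiag a
  · simpa [wignerMatrix, h, not_lt_of_gt h] using hoff ⟨(b, a), h⟩

end IsWignerFamily

end Entries

/-! ### Vanishing covariances of walk weights -/

section Weights

variable {Ω V 𝕜 : Type*} [DecidableEq V] [RCLike 𝕜] [MeasurableSpace Ω]

theorem measurable_pathWeight [MeasurableSpace 𝕜] [BorelSpace 𝕜] {X : Ω → Matrix V V 𝕜}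
    {u : ℕ → V} : ∀ j, (∀ i < j, Measurable fun ω => X ω (u i) (u (i + 1))) →
      Measurable fun ω => pathWeight (X ω) u j
  | 0, _ => measurable_const
  | 1, h => h 0 one_pos
  | j + 2, h => by
    have h1 := measurable_pathWeight (X := X) (u := u) (j + 1) fun i hi => h i (by omega)
    have h2 := measurable_pathWeight (X := X) (u := u) j fun i hi => h i (by omega)
    simp only [pathWeight]
    refine (h1.mul (h (j + 1) (by omega))).sub ?_
    split_ifs
    exacts [h2, measurable_const]

theorem measurable_cycleWeight [MeasurableSpace 𝕜] [BorelSpace 𝕜] {X : Ω → Matrix V V 𝕜} {u : ℕ → V}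
    (h : ∀ i, Measurable fun ω => X ω (u i) (u (i + 1))) :
    ∀ k, Measurable fun ω => cycleWeight (X ω) u k
  | 0 => measurable_const
  | 1 => h 0
  | k + 2 => by
    have h1 := measurable_pathWeight (X := X) (u := u) (k + 2) fun i _ => h i
    have h2 := measurable_pathWeight (X := X) (u := fun i => u (i + 1)) k fun i _ => h (i + 1)
    simp only [cycleWeight]
    refine h1.sub ?_
    split_ifs
    exacts [h2, measurable_const]

variable {P : Measure Ω} [IsProbabilityMeasure P]

theorem hasUniformMoments_pathWeight {X : Ω → Matrix V V 𝕜}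
    (hX : HasUniformMoments P fun (e : V × V) ω => X ω e.1 e.2) :
    ∀ j, HasUniformMoments P fun (u : ℕ → V) ω => pathWeight (X ω) u j
  | 0 => HasUniformMoments.const (fun _ => (1 : 𝕜)) (K := 1) fun _ => by simp
  | 1 => hX.comp fun u : ℕ → V => (u 0, u 1)
  | j + 2 => ((hasUniformMoments_pathWeight hX (j + 1)).mul
      (hX.comp fun u : ℕ → V => (u (j + 1), u (j + 2)))).sub
        ((hasUniformMoments_pathWeight hX j).ite fun u => u j = u (j + 2))

theorem hasUniformMoments_cycleWeight {X : Ω → Matrix V V 𝕜}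
    (hX : HasUniformMoments P fun (e : V × V) ω => X ω e.1 e.2) :
    ∀ k, HasUniformMoments P fun (u : ℕ → V) ω => cycleWeight (X ω) u k
  | 0 => HasUniformMoments.const (fun _ => (0 : 𝕜)) (K := 0) fun _ => by simp
  | 1 => hX.comp fun u : ℕ → V => (u 0, u 1)
  | k + 2 => (hasUniformMoments_pathWeight hX (k + 2)).sub
      (((hasUniformMoments_pathWeight hX k).comp fun (u : ℕ → V) i => u (i + 1)).ite
        fun u : ℕ → V => u (k + 1) = u (k + 3))

theorem cycleWeight_shift_add {R : Type*} [CommRing R] (X : Matrix V V R) (u : ℕ → V) (k : ℕ)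
    (hu : ∀ i, u (i + k) = u i) (n : ℕ) :
    cycleWeight X (fun i => u (i + n)) k = cycleWeight X u k := by
  induction n with
  | zero => rfl
  | succ n ih =>
    rw [← ih, ← cycleWeight_shift X (fun i => u (i + n)) k fun i => by
      rw [add_right_comm, hu]]
    simp only [add_assoc, add_comm 1 n]

end Weights

/-- The real symmetric (`κ = 1`) and the Hermitian (`κ = 0`) covariance assumptions in a common
form. With `1 + κ = 2 / β`, a pair of entries in the same orientation has covariance `κ c`, and in
opposite orientations `c`. -/
structure IsWignerOfParameter {Ω : Type*} [MeasurableSpace Ω] (P : Measure Ω) {𝕜 : Type*}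
    [RCLike 𝕜] [MeasurableSpace 𝕜] (Y : ℕ+ → ℝ → Ω → ℝ) (Z : UpperPair → ℝ → Ω → 𝕜) (κ : ℝ)
    (c : ℝ → ℝ → ℝ) : Prop extends IsWignerFamily P Y Z where
  parameter : κ = 0 ∨ κ = 1
  cov_self : ∀ t, c t t = 1
  diag_mul : ∀ s t, ∫ ω, Y 1 s ω * Y 1 t ω ∂P = (1 + κ) * c s t
  off_mul : ∀ s t, ∫ ω, Z pairOneTwo s ω * Z pairOneTwo t ω ∂P = ((κ * c s t : ℝ) : 𝕜)
  off_mul_star : ∀ s t, ∫ ω, Z pairOneTwo s ω * star (Z pairOneTwo t ω) ∂P = (c s t : 𝕜)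
  off_sq_sq : ∀ s t, ∫ ω, ‖Z pairOneTwo s ω‖ ^ 2 * ‖Z pairOneTwo t ω‖ ^ 2 ∂P
    = (1 + κ) * c s t ^ 2 + 1

theorem IsRealWigner.isWignerOfParameter {Ω : Type*} [MeasurableSpace Ω] {P : Measure Ω}
    {Y : ℕ+ → ℝ → Ω → ℝ} {Z : UpperPair → ℝ → Ω → ℝ} (h : IsRealWigner P Y Z) :
    IsWignerOfParameter P Y Z 1 (diagCov P 1 Y) where
  toIsWignerFamily := h.toIsWignerFamily
  parameter := Or.inr rfl
  cov_self := h.cov_self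
  diag_mul s t := by rw [diagCov]; ring
  off_mul s t := by simpa using h.off_cov s t
  off_mul_star s t := by simpa using h.off_cov s t
  off_sq_sq s t := by
    simp only [Real.norm_eq_abs, sq_abs]
    rw [h.off_sq_sq]
    ring

theorem IsHermitianWigner.isWignerOfParameter {Ω : Type*} [MeasurableSpace Ω] {P : Measure Ω}
    {Y : ℕ+ → ℝ → Ω → ℝ} {Z : UpperPair → ℝ → Ω → ℂ} (h : IsHermitianWigner P Y Z) :
    IsWignerOfParameter P Y Z 0 (diagCov P 2 Y) where
  toIsWignerFamily := h.toIsWignerFamily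
  parameter := Or.inl rfl
  cov_self := h.cov_self
  diag_mul s t := by rw [diagCov]; ring
  off_mul s t := by simpa using h.off_prod s t
  off_mul_star s t := h.off_cov s t
  off_sq_sq s t := by rw [h.off_sq_sq]; ring

namespace IsWignerOfParameter

variable {Ω 𝕜 : Type*} [RCLike 𝕜] [MeasurableSpace 𝕜] [MeasurableSpace Ω]
  {P : Measure Ω} {Y : ℕ+ → ℝ → Ω → ℝ} {Z : UpperPair → ℝ → Ω → 𝕜} {κ : ℝ} {c : ℝ → ℝ → ℝ}
  (hW : IsWignerOfParameter P Y Z κ c)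
include hW

theorem integral_diag_mul (a : ℕ+) (s t : ℝ) :
    ∫ ω, wignerMatrix Y Z s ω a a * wignerMatrix Y Z t ω a a ∂P = (((1 + κ) * c s t : ℝ) : 𝕜) := by
  simp only [wignerMatrix, lt_irrefl, dite_false]
  simp_rw [← RCLike.ofReal_mul]
  rw [integral_ofReal, hW.integral_diag_eq a (F := fun z => z s * z t) (by fun_prop), hW.diag_mul]

variable [BorelSpace 𝕜]

theorem integral_off (e : UpperPair) (t : ℝ) : ∫ ω, Z e t ω ∂P = 0 :=
  (hW.integral_off_eq e (F := fun z => z t) (by fun_prop)).trans (hW.mean_off t)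

theorem integral_wignerMatrix (t : ℝ) (a b : ℕ+) : ∫ ω, wignerMatrix Y Z t ω a b ∂P = 0 := by
  rcases lt_trichotomy a b with h | rfl | h
  · simpa [wignerMatrix, h] using hW.integral_off ⟨(a, b), h⟩ t
  · simp only [wignerMatrix, lt_irrefl, dite_false]
    rw [integral_ofReal, hW.integral_diag_eq a (F := fun z => z t) (by fun_prop), hW.mean_diag,
      RCLike.ofReal_zero]
  · simp only [wignerMatrix, h, not_lt_of_gt h, dite_true, dite_false]
    exact integral_conj.trans (by rw [hW.integral_off, map_zero])

theorem integral_off_mul_star (e : UpperPair) (s t : ℝ) :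
    ∫ ω, Z e s ω * star (Z e t ω) ∂P = (c s t : 𝕜) := by
  refine (hW.integral_off_eq e (F := fun z => z s * star (z t)) ?_).trans (hW.off_mul_star s t)
  exact (measurable_pi_apply s).mul (continuous_star.measurable.comp (measurable_pi_apply t))

theorem integral_off_mul (e : UpperPair) (s t : ℝ) :
    ∫ ω, Z e s ω * Z e t ω ∂P = ((κ * c s t : ℝ) : 𝕜) :=
  (hW.integral_off_eq e (F := fun z => z s * z t) (by fun_prop)).trans (hW.off_mul s t)

/-- Entries at the same position. -/
theorem integral_mul_same {a b : ℕ+} (hab : a ≠ b) (s t : ℝ) :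
    ∫ ω, wignerMatrix Y Z s ω a b * wignerMatrix Y Z t ω a b ∂P = ((κ * c s t : ℝ) : 𝕜) := by
  rcases hab.lt_or_gt with h | h
  · simpa [wignerMatrix, h] using hW.integral_off_mul ⟨(a, b), h⟩ s t
  · simp only [wignerMatrix, h, not_lt_of_gt h, dite_true, dite_false, ← star_mul']
    exact integral_conj.trans (by rw [hW.integral_off_mul, RCLike.conj_ofReal])

/-- Entries at mirrored positions. -/
theorem integral_mul_swap {a b : ℕ+} (hab : a ≠ b) (s t : ℝ) :
    ∫ ω, wignerMatrix Y Z s ω a b * wignerMatrix Y Z t ω b a ∂P = (c s t : 𝕜) := by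
  rcases hab.lt_or_gt with h | h
  · simpa [wignerMatrix, h, not_lt_of_gt h] using hW.integral_off_mul_star ⟨(a, b), h⟩ s t
  · have h1 := hW.integral_off_mul_star ⟨(b, a), h⟩ s t
    have h2 : ∫ ω, star (Z ⟨(b, a), h⟩ s ω) * Z ⟨(b, a), h⟩ t ω ∂P
        = ∫ ω, star (Z ⟨(b, a), h⟩ s ω * star (Z ⟨(b, a), h⟩ t ω)) ∂P := by simp
    simp only [wignerMatrix, h, not_lt_of_gt h, dite_true, dite_false]
    rw [h2]
    exact integral_conj.trans (by rw [h1, RCLike.conj_ofReal])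

/-- The fourth mixed moment `E[|X(s)| ^ 2 |X(t)| ^ 2]` of an entry off the diagonal. -/
theorem integral_sq_mul_sq {a b : ℕ+} (hab : a ≠ b) (s t : ℝ) :
    ∫ ω, (wignerMatrix Y Z s ω a b * wignerMatrix Y Z s ω b a)
      * (wignerMatrix Y Z t ω a b * wignerMatrix Y Z t ω b a) ∂P
        = (((1 + κ) * c s t ^ 2 + 1 : ℝ) : 𝕜) := by
  have key : ∀ e : UpperPair, ∫ ω, (Z e s ω * star (Z e s ω)) * (Z e t ω * star (Z e t ω)) ∂P
      = (((1 + κ) * c s t ^ 2 + 1 : ℝ) : 𝕜) := by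
    intro e
    have h1 : ∀ z : 𝕜, z * star z = ((‖z‖ ^ 2 : ℝ) : 𝕜) := fun z => by
      rw [RCLike.ofReal_pow]
      exact RCLike.mul_conj z
    simp_rw [h1, ← RCLike.ofReal_mul]
    rw [integral_ofReal, hW.integral_off_eq e (F := fun z => ‖z s‖ ^ 2 * ‖z t‖ ^ 2) (by fun_prop),
      hW.off_sq_sq]
  rcases hab.lt_or_gt with h | h
  · simpa [wignerMatrix, h, not_lt_of_gt h] using key ⟨(a, b), h⟩
  · simpa [wignerMatrix, h, not_lt_of_gt h, mul_comm] using key ⟨(b, a), h⟩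

theorem bilinCov_mul_eq_zero {S : Set (ℕ+ ⊕ UpperPair)} {x h g : Ω → 𝕜}
    (hx : Measurable[entrySigma Y Z S] x) (hx0 : ∫ ω, x ω ∂P = 0)
    (hh : Measurable[entrySigma Y Z Sᶜ] h) (hg : Measurable[entrySigma Y Z Sᶜ] g) :
    bilinCov P (fun ω => x ω * h ω) g = 0 := by
  have h1 : ∫ ω, x ω * h ω ∂P = 0 := by
    rw [hW.integral_mul_of_disjoint disjoint_compl_right hx hh, hx0, zero_mul]
  have h2 : ∫ ω, x ω * h ω * g ω ∂P = 0 := by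
    simp_rw [mul_assoc]
    rw [hW.integral_mul_of_disjoint disjoint_compl_right
      (g := fun ω => h ω * g ω) hx (hh.mul hg), hx0, zero_mul]
  rw [bilinCov, h1, h2, zero_mul, sub_zero]

/-- The case where the vertex visited only once is the last one of the walk. -/
theorem bilinCov_cycleWeight_eq_zero_of_last [IsProbabilityMeasure P] {k : ℕ} {u : ℕ → ℕ+}
    (hu : ∀ i, u (i + (k + 1)) = u i) (hk : ∀ i < k, u i ≠ u k) (t : ℝ) {g : Ω → 𝕜}
    (hg : Measurable[entrySigma Y Z {entryLabel (u k) (u 0)}ᶜ] g) :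
    bilinCov P (fun ω => cycleWeight (wignerMatrix Y Z t ω) u (k + 1)) g = 0 := by
  have hX {S : Set (ℕ+ ⊕ UpperPair)} {a b : ℕ+} (h : entryLabel a b ∈ S) :
      Measurable[entrySigma Y Z S] fun ω => wignerMatrix Y Z t ω a b :=
    measurable_wignerMatrix_entrySigma h t
  have hS : entryLabel (u k) (u 0) ∈ ({entryLabel (u k) (u 0)} : Set (ℕ+ ⊕ UpperPair)) :=
    Set.mem_singleton _
  have hS' : entryLabel (u 0) (u k) ∈ ({entryLabel (u k) (u 0)} : Set (ℕ+ ⊕ UpperPair)) :=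
    Set.mem_singleton_iff.2 (entryLabel_comm _ _)
  match k with
  | 0 =>
    have h1 : u 1 = u 0 := hu 0
    refine hW.bilinCov_eq_zero_of_disjoint disjoint_compl_right ?_ hg
    simp only [cycleWeight, h1]
    exact hX hS
  | 1 =>
    have h2 : u 2 = u 0 := hu 0
    have h3 : u 3 = u 1 := hu 1
    refine hW.bilinCov_eq_zero_of_disjoint disjoint_compl_right ?_ hg
    simp only [cycleWeight, pathWeight, zero_add, h2, h3, if_true]
    exact (((hX hS').mul (hX hS)).sub measurable_const).sub measurable_const
  | k + 2 =>
    have h0 : u (k + 3) = u 0 := by simpa using hu 0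
    have h1 : u (k + 4) = u 1 := by rw [← hu 1]; congr 1; omega
    simp_rw [cycleWeight_eq_mul _ u k h0 h1 hk]
    have hpath : Measurable[entrySigma Y Z {entryLabel (u (k + 2)) (u 0)}ᶜ]
        fun ω => pathWeight (wignerMatrix Y Z t ω) u (k + 1) := by
      refine @measurable_pathWeight Ω ℕ+ 𝕜 _ _ (entrySigma Y Z _) _ _ _ _ _ fun i hi => hX ?_
      rw [Set.mem_compl_singleton_iff, Ne, entryLabel_eq_iff]
      rintro (⟨h, -⟩ | ⟨-, h⟩)
      · exact hk i (by omega) h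
      · exact hk (i + 1) (by omega) h
    -- The last vertex is the middle of a backtrack, or it is reached and left by different edges.
    by_cases hb : u (k + 1) = u 0
    · simp only [hb, if_true]
      refine hW.bilinCov_mul_eq_zero ?_ ?_ hpath hg
      · exact ((hX hS').mul (hX hS)).sub measurable_const
      · have hm := (hW.hasUniformMoments_wignerMatrix t)
        have hi := ((hm.comp fun _ : Unit => (u 0, u (k + 2))).mul
          (hm.comp fun _ : Unit => (u (k + 2), u 0))).integrable ()
        rw [integral_sub hi (integrable_const _), hW.integral_mul_swap (hk 0 (by omega)),
          hW.cov_self]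
        simp
    · simp only [hb, if_false, sub_zero]
      have h2 : ∀ ω, wignerMatrix Y Z t ω (u (k + 1)) (u (k + 2))
          * wignerMatrix Y Z t ω (u (k + 2)) (u 0) * pathWeight (wignerMatrix Y Z t ω) u (k + 1)
          = wignerMatrix Y Z t ω (u (k + 2)) (u 0) * (wignerMatrix Y Z t ω (u (k + 1)) (u (k + 2))
            * pathWeight (wignerMatrix Y Z t ω) u (k + 1)) := fun ω => by ring
      simp_rw [h2]
      refine hW.bilinCov_mul_eq_zero (hX hS) (hW.integral_wignerMatrix t _ _)
        ((hX ?_).mul hpath) hg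
      rw [Set.mem_compl_singleton_iff, Ne, entryLabel_eq_iff]
      rintro (⟨h, -⟩ | ⟨h, -⟩)
      · exact hk (k + 1) (by omega) h
      · exact hb h

/-- The key cancellation: if the closed walk `u` visits the vertex `u s` only once, and the closed
walk `v` does not use the edge from `u s` to `u (s + 1)`, then their weights are uncorrelated. In
the weight of `u` this edge enters either through a single centred entry or, at a backtrack, through
the centred variable `|X e| ^ 2 - 1`. -/
theorem bilinCov_cycleWeight_eq_zero [IsProbabilityMeasure P] {k l : ℕ} (hk : 0 < k) {u v : ℕ → ℕ+}
    (hu : ∀ i, u (i + k) = u i) {s : ℕ} (hs : ∀ i, u i = u s → i ≡ s [MOD k])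
    (hv : ∀ r, entryLabel (v r) (v (r + 1)) ≠ entryLabel (u s) (u (s + 1))) (t t' : ℝ) :
    bilinCov P (fun ω => cycleWeight (wignerMatrix Y Z t ω) u k)
      (fun ω => cycleWeight (wignerMatrix Y Z t' ω) v l) = 0 := by
  obtain ⟨k, rfl⟩ : ∃ j, k = j + 1 := ⟨k - 1, by omega⟩
  have hsk : u (k + (s + 1)) = u s := by rw [← hu s]; congr 1; omega
  simp_rw [← cycleWeight_shift_add _ u (k + 1) hu (s + 1)]
  refine hW.bilinCov_cycleWeight_eq_zero_of_last (u := fun i => u (i + (s + 1)))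
    (fun i => by rw [add_right_comm, hu]) (fun i hi h => ?_) t ?_
  · have h1 := hs _ (h.trans hsk)
    have h2 : (i + 1) + s ≡ 0 + s [MOD k + 1] := by
      rw [zero_add]
      convert h1 using 1
      omega
    have h3 := Nat.ModEq.add_right_cancel' s h2
    have h4 := Nat.le_of_dvd (by omega) ((Nat.modEq_zero_iff_dvd).1 h3)
    omega
  · refine @measurable_cycleWeight Ω ℕ+ 𝕜 _ _ (entrySigma Y Z _) _ _ _ _ (fun r => ?_) l
    refine measurable_wignerMatrix_entrySigma ?_ t'
    rw [Set.mem_compl_singleton_iff, hsk, zero_add]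
    exact hv r

theorem bilinCov_cycleWeight_eq_zero_of_disjoint {k l : ℕ} {u v : ℕ → ℕ+}
    (huv : ∀ i j, u i ≠ v j) (t t' : ℝ) :
    bilinCov P (fun ω => cycleWeight (wignerMatrix Y Z t ω) u k)
      (fun ω => cycleWeight (wignerMatrix Y Z t' ω) v l) = 0 := by
  have hm (w : ℕ → ℕ+) (n : ℕ) (r : ℝ) :
      Measurable[entrySigma Y Z (Set.range fun i => entryLabel (w i) (w (i + 1)))]
        fun ω => cycleWeight (wignerMatrix Y Z r ω) w n :=
    @measurable_cycleWeight Ω ℕ+ 𝕜 _ _ (entrySigma Y Z _) _ _ _ _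
      (fun i => measurable_wignerMatrix_entrySigma (Set.mem_range_self i) r) n
  refine hW.bilinCov_eq_zero_of_disjoint ?_ (hm u k t) (hm v l t')
  rw [Set.disjoint_left]
  rintro _ ⟨i, rfl⟩ ⟨j, h⟩
  rcases entryLabel_eq_iff.1 h with ⟨h, -⟩ | ⟨h, -⟩
  · exact huv _ _ h.symm
  · exact huv _ _ h.symm

end IsWignerOfParameter

/-! ### Counting closed walks -/

section Cyclic

theorem Fin.cyclic_induction {k : ℕ} [NeZero k] {p : Fin k → Prop} (j₀ : Fin k) (h₀ : p j₀)
    (h : ∀ j, p j → p (j + 1)) (j : Fin k) : p j := by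
  have h1 : ∀ n : ℕ, p (j₀ + Fin.ofNat k n) := by
    intro n
    induction n with
    | zero =>
      convert h₀
      ext
      simp
    | succ n ih =>
      convert h _ ih using 1
      ext
      simp [Fin.val_add, add_assoc]
  have h2 := h1 (j - j₀).val
  rwa [show Fin.ofNat k (j - j₀).val = j - j₀ from Fin.ofNat_val_eq_self _, add_sub_cancel] at h2

theorem add_one_ne_self {k : ℕ} [NeZero k] (hk : 2 ≤ k) (s : Fin k) : s + 1 ≠ s := by
  intro h
  have h1 : (1 : Fin k) = 0 := by simpa using h
  have h2 := congrArg Fin.val h1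
  rw [Fin.val_one', Fin.val_zero, Nat.mod_eq_of_lt (by omega)] at h2
  omega

theorem add_one_add_one_ne_self {k : ℕ} [NeZero k] (hk : 3 ≤ k) (s : Fin k) : s + 1 + 1 ≠ s := by
  intro h
  have h1 : (1 + 1 : Fin k) = 0 := by
    rw [add_assoc] at h
    simpa using h
  have h2 := congrArg Fin.val h1
  rw [Fin.val_add, Fin.val_one', Fin.val_zero, Nat.mod_eq_of_lt (by omega : 1 < k),
    Nat.mod_eq_of_lt (by omega)] at h2
  omega

variable {V : Type*} {k : ℕ} [NeZero k]

theorem periodize_val (w : Fin k → V) (s : Fin k) : periodize w s.val = w s := by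
  rw [periodize, Fin.ofNat_val_eq_self]

theorem ofNat_add_one (i : ℕ) : Fin.ofNat k (i + 1) = Fin.ofNat k i + 1 := by
  ext
  simp [Fin.val_add]

theorem periodize_succ (w : Fin k → V) (i : ℕ) :
    periodize w (i + 1) = w (Fin.ofNat k i + 1) := by
  rw [periodize, ofNat_add_one]

/-- An injective map from the cycle `Fin k` to itself that moves by one step at a time cannot turn
back, hence is a rotation or a reflection. -/
theorem eq_add_or_eq_sub_of_steps {σ : Fin k → Fin k} (hk : 3 ≤ k) (hσ : Function.Injective σ)
    (h : ∀ r, σ (r + 1) = σ r + 1 ∨ σ (r + 1) = σ r - 1) :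
    (∀ r, σ r = σ 0 + r) ∨ ∀ r, σ r = σ 0 - r := by
  rcases h 0 with h0 | h0
  · left
    have h1 := Fin.cyclic_induction (p := fun r => σ (r + 1) = σ r + 1) 0 h0 fun r hr =>
      (h (r + 1)).resolve_right fun h3 => add_one_add_one_ne_self hk r
        (hσ (by rw [h3, hr, add_sub_cancel_right]))
    exact Fin.cyclic_induction 0 (by simp) fun r hr => by rw [h1, hr, add_assoc]
  · right
    have h1 := Fin.cyclic_induction (p := fun r => σ (r + 1) = σ r - 1) 0 h0 fun r hr =>
      (h (r + 1)).resolve_left fun h3 => add_one_add_one_ne_self hk r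
        (hσ (by rw [h3, hr, sub_add_cancel]))
    exact Fin.cyclic_induction 0 (by simp) fun r hr => by rw [h1, hr, sub_sub]

end Cyclic

section Counting

variable {V : Type*}

theorem sum_univ_eq_sum_piFinset {R : Type*} [AddCommMonoid R] (k : ℕ) (B : Finset V)
    (f : (Fin k → V) → R) :
    ∑ w : Fin k → B, f (fun i => w i) = ∑ w ∈ Fintype.piFinset fun _ : Fin k => B, f w := by
  refine Finset.sum_bij' (fun w _ i => (w i : V))
    (fun w hw i => ⟨w i, Fintype.mem_piFinset.1 hw i⟩) ?_ ?_ ?_ ?_ ?_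
  · exact fun w _ => Fintype.mem_piFinset.2 fun i => (w i).2
  · exact fun w _ => Finset.mem_univ _
  · exact fun w _ => rfl
  · exact fun w _ => rfl
  · exact fun w _ => rfl

variable [DecidableEq V]

/-- Pairs of tuples with at most `r` values in all are determined by a list of `r` values and the
pattern in which they occur. -/
theorem card_filter_image_union_le {k l : ℕ} [NeZero k] (r : ℕ) (B B' : Finset V) :
    ((Fintype.piFinset (fun _ : Fin k => B) ×ˢ Fintype.piFinset (fun _ : Fin l => B')).filter
      fun p => (Finset.univ.image p.1 ∪ Finset.univ.image p.2).card ≤ r).card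
        ≤ (B ∪ B').card ^ r * (r ^ k * r ^ l) := by
  classical
  have hcard : (Fintype.piFinset (fun _ : Fin r => B ∪ B') ×ˢ
      (Finset.univ : Finset ((Fin k → Fin r) × (Fin l → Fin r)))).card
      = (B ∪ B').card ^ r * (r ^ k * r ^ l) := by
    simp [Finset.card_product]
  rw [← hcard]
  refine Finset.card_le_card_of_surjOn (fun q => (fun i => q.1 (q.2.1 i), fun i => q.1 (q.2.2 i)))
    fun ⟨w, x⟩ hp => ?_
  simp only [Finset.coe_filter, Finset.mem_product, Fintype.mem_piFinset, Set.mem_ofPred_eq] at hp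
  obtain ⟨⟨hw, hx⟩, hr⟩ := hp
  set A := Finset.univ.image w ∪ Finset.univ.image x with hA
  have hwA : ∀ i, w i ∈ A := fun i => by simp [hA]
  have hxA : ∀ i, x i ∈ A := fun i => by simp [hA]
  have hsurj : ∃ h : Fin r → V, (∀ i, h i ∈ A) ∧ ∀ a ∈ A, ∃ i, h i = a := by
    refine ⟨fun i => if hi : i.val < A.card then A.equivFin.symm ⟨i, hi⟩ else w 0, fun i => ?_,
      fun a ha => ⟨⟨A.equivFin ⟨a, ha⟩, lt_of_lt_of_le (Fin.is_lt _) hr⟩, by simp⟩⟩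
    dsimp only
    split_ifs
    exacts [Subtype.coe_prop _, hwA 0]
  obtain ⟨h, hhA, hh⟩ := hsurj
  choose g hg using fun i => hh _ (hwA i)
  choose g' hg' using fun i => hh _ (hxA i)
  refine ⟨(h, g, g'), ?_, Prod.ext (funext hg) (funext hg')⟩
  simp only [Finset.coe_product, Finset.coe_univ, Set.mem_prod, Set.mem_univ, and_true,
    Finset.mem_coe, Fintype.mem_piFinset]
  intro i
  have h1 := hhA i
  rw [hA, Finset.mem_union, Finset.mem_image, Finset.mem_image] at h1
  rw [Finset.mem_union]
  rcases h1 with ⟨j, -, h1⟩ | ⟨j, -, h1⟩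
  · exact Or.inl (h1 ▸ hw j)
  · exact Or.inr (h1 ▸ hx j)

theorem card_filter_injective_piFinset (k : ℕ) (A : Finset V) :
    ((Fintype.piFinset fun _ : Fin k => A).filter Function.Injective).card
      = A.card.descFactorial k := by
  have h : A.card.descFactorial k = Fintype.card (Fin k ↪ A) := by simp
  rw [h, ← Finset.card_univ]
  symm
  refine Finset.card_bij' (fun e _ i => (e i : V))
    (fun w hw => ⟨fun i => ⟨w i, Fintype.mem_piFinset.1 (Finset.mem_filter.1 hw).1 i⟩,
      fun i j hij => (Finset.mem_filter.1 hw).2 (Subtype.mk.inj hij)⟩) ?_ ?_ ?_ ?_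
  · intro e _
    rw [Finset.mem_filter, Fintype.mem_piFinset]
    exact ⟨fun i => (e i).2, Subtype.val_injective.comp e.injective⟩
  · intro w hw
    exact Finset.mem_univ _
  · intro e _
    rfl
  · intro w hw
    rfl

/-- The total numbers of visits of two closed walks to each vertex add up to the total length. -/
theorem sum_card_fiber_add_card_fiber {k l : ℕ} (w : Fin k → V) (x : Fin l → V) :
    ∑ a ∈ Finset.univ.image w ∪ Finset.univ.image x,
      ((Finset.univ.filter fun i => w i = a).card + (Finset.univ.filter fun i => x i = a).card)
        = k + l := by
  rw [Finset.sum_add_distrib, ← Finset.card_eq_sum_card_fiberwise (f := w) (s := Finset.univ),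
    ← Finset.card_eq_sum_card_fiberwise (f := x) (s := Finset.univ)]
  · simp
  · intro i _
    simp
  · intro i _
    simp

end Counting

/-! ### Correlated pairs of closed walks -/

section WalkCov

variable {Ω 𝕜 : Type*} [RCLike 𝕜] [MeasurableSpace Ω]

/-- The covariance of the weights of the closed walks `w` at time `t` and `x` at time `t'`. -/
noncomputable def walkCov (P : Measure Ω) (Y : ℕ+ → ℝ → Ω → ℝ) (Z : UpperPair → ℝ → Ω → 𝕜)
    (t t' : ℝ) {k l : ℕ} [NeZero k] [NeZero l] (w : Fin k → ℕ+) (x : Fin l → ℕ+) : 𝕜 :=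
  bilinCov P (fun ω => cycleWeight (wignerMatrix Y Z t ω) (periodize w) k)
    (fun ω => cycleWeight (wignerMatrix Y Z t' ω) (periodize x) l)

theorem walkCov_comm (P : Measure Ω) (Y : ℕ+ → ℝ → Ω → ℝ) (Z : UpperPair → ℝ → Ω → 𝕜)
    (t t' : ℝ) {k l : ℕ} [NeZero k] [NeZero l] (w : Fin k → ℕ+) (x : Fin l → ℕ+) :
    walkCov P Y Z t t' w x = walkCov P Y Z t' t x w :=
  bilinCov_comm _ _

end WalkCov

namespace IsWignerOfParameter

variable {Ω 𝕜 : Type*} [RCLike 𝕜] [MeasurableSpace 𝕜] [BorelSpace 𝕜] [MeasurableSpace Ω]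
  {P : Measure Ω} [IsProbabilityMeasure P] {Y : ℕ+ → ℝ → Ω → ℝ} {Z : UpperPair → ℝ → Ω → 𝕜}
  {κ : ℝ} {c : ℝ → ℝ → ℝ} (hW : IsWignerOfParameter P Y Z κ c)
  {k l : ℕ} [NeZero k] [NeZero l] {w : Fin k → ℕ+} {x : Fin l → ℕ+} {t t' : ℝ}
include hW

theorem walkCov_eq_zero {s : Fin k} (hs : ∀ j, w j = w s → j = s)
    (hx : ∀ r, entryLabel (x r) (x (r + 1)) ≠ entryLabel (w s) (w (s + 1))) :
    walkCov P Y Z t t' w x = 0 := by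
  refine hW.bilinCov_cycleWeight_eq_zero (Nat.pos_of_neZero k) (s := s) (periodize_add w)
    (fun i hi => ?_) (fun r => ?_) t t'
  · rw [periodize_val] at hi
    have h := congrArg Fin.val (hs _ hi)
    rw [Nat.ModEq, Nat.mod_eq_of_lt s.isLt, ← h]
    rfl
  · rw [periodize_succ, periodize_succ, Fin.ofNat_val_eq_self, periodize_val]
    exact hx _

/-- Correlated closed walks share every edge that leaves a vertex visited only once. -/
theorem exists_edge_eq (h : walkCov P Y Z t t' w x ≠ 0) {s : Fin k} (hs : ∀ j, w j = w s → j = s) :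
    ∃ r, entryLabel (x r) (x (r + 1)) = entryLabel (w s) (w (s + 1)) := by
  by_contra! hne
  exact h (hW.walkCov_eq_zero hs hne)

/-- A vertex of two correlated closed walks is visited at least twice by the two together. -/
theorem two_le_card_fiber_add_card_fiber (h : walkCov P Y Z t t' w x ≠ 0) {a : ℕ+}
    (ha : a ∈ Finset.univ.image w) :
    2 ≤ (Finset.univ.filter fun i => w i = a).card
      + (Finset.univ.filter fun i => x i = a).card := by
  obtain ⟨s, -, rfl⟩ := Finset.mem_image.1 ha
  by_contra! hlt
  have hpos : 0 < (Finset.univ.filter fun i => w i = w s).card :=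
    Finset.card_pos.2 ⟨s, by simp⟩
  have h1 : (Finset.univ.filter fun i => w i = w s).card ≤ 1 := by omega
  have h2 : (Finset.univ.filter fun i => x i = w s) = ∅ := Finset.card_eq_zero.1 (by omega)
  obtain ⟨r, hr⟩ := hW.exists_edge_eq h fun j hj =>
    Finset.card_le_one.1 h1 j (by simpa using hj) s (by simp)
  have h3 : ∀ i, x i ≠ w s := fun i hi =>
    Finset.notMem_empty i (h2 ▸ Finset.mem_filter.2 ⟨Finset.mem_univ i, hi⟩)
  rcases entryLabel_eq_iff.1 hr with ⟨h4, -⟩ | ⟨-, h4⟩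
  · exact h3 _ h4
  · exact h3 _ h4

/-- If every vertex is visited exactly twice in all, then a correlated closed walk is a simple
cycle, and all its vertices are common to both walks. -/
theorem injective_of_card_fiber_eq_two (h : walkCov P Y Z t t' w x ≠ 0)
    (h2 : ∀ a ∈ Finset.univ.image w ∪ Finset.univ.image x,
      (Finset.univ.filter fun i => w i = a).card + (Finset.univ.filter fun i => x i = a).card = 2) :
    Function.Injective w ∧ Finset.univ.image w ⊆ Finset.univ.image x := by
  have hex : ∃ i, w i ∈ Finset.univ.image x := by
    by_contra! hne
    refine h (hW.bilinCov_cycleWeight_eq_zero_of_disjoint (fun i j hij => ?_) t t')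
    exact hne (Fin.ofNat k i) (Finset.mem_image.2 ⟨Fin.ofNat l j, Finset.mem_univ _, hij.symm⟩)
  -- A common vertex is visited exactly once by each walk.
  have hone : ∀ i, w i ∈ Finset.univ.image x →
      (Finset.univ.filter fun j => w j = w i).card ≤ 1 := by
    intro i hi
    have h3 := h2 _ (Finset.mem_union_right _ hi)
    have h4 : 0 < (Finset.univ.filter fun j => x j = w i).card := by
      obtain ⟨j, -, hj⟩ := Finset.mem_image.1 hi
      exact Finset.card_pos.2 ⟨j, by simpa using hj⟩
    omega
  have huniq : ∀ i, w i ∈ Finset.univ.image x → ∀ j, w j = w i → j = i := fun i hi j hj =>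
    Finset.card_le_one.1 (hone i hi) j (by simpa using hj) i (by simp)
  obtain ⟨i₀, hi₀⟩ := hex
  -- From a common vertex the walk `w` can only move on to a common vertex.
  have hall := Fin.cyclic_induction (p := fun i => w i ∈ Finset.univ.image x) i₀ hi₀ fun i hi => by
    obtain ⟨r, hr⟩ := hW.exists_edge_eq h (huniq i hi)
    rcases entryLabel_eq_iff.1 hr with ⟨-, h4⟩ | ⟨h4, -⟩
    · exact Finset.mem_image.2 ⟨_, Finset.mem_univ _, h4⟩
    · exact Finset.mem_image.2 ⟨_, Finset.mem_univ _, h4⟩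
  refine ⟨fun i j hij => huniq j (hall j) i hij, fun a ha => ?_⟩
  obtain ⟨i, -, rfl⟩ := Finset.mem_image.1 ha
  exact hall i

/-- Correlated closed walks either visit few vertices in all, or are simple cycles through the same
vertices. -/
theorem card_lt_or_injective (h : walkCov P Y Z t t' w x ≠ 0) :
    2 * (Finset.univ.image w ∪ Finset.univ.image x).card < k + l ∨
      (Function.Injective w ∧ Function.Injective x ∧
        Finset.univ.image w = Finset.univ.image x) := by
  have h' : walkCov P Y Z t' t x w ≠ 0 := by rwa [walkCov_comm]
  set A := Finset.univ.image w ∪ Finset.univ.image x with hA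
  have hge : ∀ a ∈ A, 2 ≤ (Finset.univ.filter fun i => w i = a).card
      + (Finset.univ.filter fun i => x i = a).card := by
    intro a ha
    rcases Finset.mem_union.1 ha with ha | ha
    · exact hW.two_le_card_fiber_add_card_fiber h ha
    · rw [add_comm]
      exact hW.two_le_card_fiber_add_card_fiber h' ha
  have hsum := sum_card_fiber_add_card_fiber w x
  have hconst : ∑ a ∈ A, 2 = 2 * A.card := by rw [Finset.sum_const, smul_eq_mul, mul_comm]
  rcases (hconst ▸ hsum ▸ Finset.sum_le_sum hge : 2 * A.card ≤ k + l).lt_or_eq with hlt | heq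
  · exact Or.inl hlt
  right
  have h2 := (Finset.sum_eq_sum_iff_of_le hge).1 (by rw [hconst, heq, hsum])
  have hw := hW.injective_of_card_fiber_eq_two h fun a ha => (h2 a ha).symm
  have hx := hW.injective_of_card_fiber_eq_two h' fun a ha => by
    rw [add_comm]
    exact (h2 a (by rwa [hA, Finset.union_comm])).symm
  exact ⟨hw.1, hx.1, hw.2.antisymm hx.2⟩

omit hW in
/-- Only the pairs of simple cycles through the same vertices contribute to leading order. -/
theorem exists_norm_sum_walkCov_sub_le (hW : IsWignerOfParameter P Y Z κ c) (k l : ℕ) [NeZero k]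
    [NeZero l] (t t' : ℝ) : ∃ C : ℝ, ∀ B B' : Finset ℕ+,
      ‖∑ p ∈ Fintype.piFinset (fun _ : Fin k => B) ×ˢ Fintype.piFinset (fun _ : Fin l => B'),
          walkCov P Y Z t t' p.1 p.2
        - ∑ p ∈ (Fintype.piFinset (fun _ : Fin k => B) ×ˢ
            Fintype.piFinset (fun _ : Fin l => B')).filter (fun p => Function.Injective p.1 ∧
              Function.Injective p.2 ∧ Finset.univ.image p.1 = Finset.univ.image p.2),
          walkCov P Y Z t t' p.1 p.2‖ ≤ C * ((B ∪ B').card : ℝ) ^ ((k + l - 1) / 2) := by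
  obtain ⟨C, hC⟩ := exists_norm_bilinCov_le
    (hasUniformMoments_cycleWeight (hW.hasUniformMoments_wignerMatrix t) k)
    (hasUniformMoments_cycleWeight (hW.hasUniformMoments_wignerMatrix t') l)
  set r := (k + l - 1) / 2 with hr
  have hC0 : 0 ≤ C := (norm_nonneg _).trans (hC (fun _ => 1) fun _ => 1)
  refine ⟨C * (r ^ k * r ^ l : ℕ), fun B B' => ?_⟩
  set U := Fintype.piFinset (fun _ : Fin k => B) ×ˢ Fintype.piFinset (fun _ : Fin l => B') with hU
  rw [← Finset.sum_filter_add_sum_filter_not U (fun p => Function.Injective p.1 ∧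
    Function.Injective p.2 ∧ Finset.univ.image p.1 = Finset.univ.image p.2), add_sub_cancel_left]
  rw [← Finset.sum_subset (s₁ := (U.filter fun p => ¬ (Function.Injective p.1 ∧
    Function.Injective p.2 ∧ Finset.univ.image p.1 = Finset.univ.image p.2)).filter
      fun p => (Finset.univ.image p.1 ∪ Finset.univ.image p.2).card ≤ r) (Finset.filter_subset _ _)]
  · refine (norm_sum_le_of_le _ fun p _ => hC (periodize p.1) (periodize p.2)).trans ?_
    rw [Finset.sum_const, nsmul_eq_mul, mul_comm, mul_assoc]
    refine mul_le_mul_of_nonneg_left ?_ hC0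
    rw [mul_comm]
    have h1 := card_filter_image_union_le (k := k) (l := l) r B B'
    have h2 : ((U.filter fun p => ¬ (Function.Injective p.1 ∧ Function.Injective p.2 ∧
        Finset.univ.image p.1 = Finset.univ.image p.2)).filter fun p =>
          (Finset.univ.image p.1 ∪ Finset.univ.image p.2).card ≤ r).card
        ≤ (B ∪ B').card ^ r * (r ^ k * r ^ l) :=
      (Finset.card_le_card (Finset.filter_subset_filter _ (Finset.filter_subset _ _))).trans h1
    exact_mod_cast h2
  · intro p hp hp'
    by_contra hne
    rw [Finset.mem_filter] at hp
    refine hp' (Finset.mem_filter.2 ⟨Finset.mem_filter.2 hp, ?_⟩)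
    have := (hW.card_lt_or_injective hne).resolve_right hp.2
    omega

end IsWignerOfParameter

/-! ### Covariances of simple cycles -/

theorem cycleWeight_periodize_eq_prod {V R : Type*} [DecidableEq V] [CommRing R]
    (X : Matrix V V R) {k : ℕ} [NeZero k] (hk : 3 ≤ k) {w : Fin k → V} (hw : Function.Injective w) :
    cycleWeight X (periodize w) k = ∏ s, X (w s) (w (s + 1)) := by
  have hne : ∀ i, periodize w i ≠ periodize w (i + 2) := by
    intro i hi
    have h1 : i + 0 ≡ i + 2 [MOD k] := congrArg Fin.val (hw hi)
    have h2 := Nat.le_of_dvd two_pos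
      ((Nat.modEq_zero_iff_dvd).1 (Nat.ModEq.add_left_cancel' i h1).symm)
    omega
  obtain ⟨j, rfl⟩ : ∃ j, k = j + 2 := ⟨k - 2, by omega⟩
  rw [cycleWeight, if_neg (hne (j + 1)), sub_zero, pathWeight_eq_prod X _ _ fun i _ => hne i,
    Finset.prod_range]
  refine Finset.prod_congr rfl fun s _ => ?_
  rw [periodize_succ, Fin.ofNat_val_eq_self, periodize_val]

theorem fin_two_add_eq_apply :
    ∀ σ : Fin 2 → Fin 2, Function.Injective σ → ∀ r, σ 0 + r = σ r := by
  decide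

theorem bilinCov_sub_const {Ω 𝕜 : Type*} [RCLike 𝕜] [MeasurableSpace Ω] {P : Measure Ω}
    [IsProbabilityMeasure P] {f g : Ω → 𝕜} (hf : Integrable f P) (hg : Integrable g P)
    (hfg : Integrable (fun ω => f ω * g ω) P) (a b : 𝕜) :
    bilinCov P (fun ω => f ω - a) (fun ω => g ω - b) = bilinCov P f g := by
  have h1 : ∀ ω, (f ω - a) * (g ω - b) = f ω * g ω - f ω * b - a * g ω + a * b := fun ω => by ring
  simp only [bilinCov, h1]
  rw [integral_add (f := fun ω => f ω * g ω - f ω * b - a * g ω)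
      ((hfg.sub (hf.mul_const b)).sub (hg.const_mul a)) (integrable_const _),
    integral_sub (f := fun ω => f ω * g ω - f ω * b) (hfg.sub (hf.mul_const b)) (hg.const_mul a),
    integral_sub hfg (hf.mul_const b),
    integral_mul_const, integral_const_mul, integral_sub hf (integrable_const _),
    integral_sub hg (integrable_const _)]
  simp only [integral_const, probReal_univ, one_smul]
  ring

theorem entryLabel_cycle_injective {k : ℕ} [NeZero k] (hk : 3 ≤ k) {w : Fin k → ℕ+}
    (hw : Function.Injective w) :
    Function.Injective fun s => entryLabel (w s) (w (s + 1)) := by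
  intro s r h
  rcases entryLabel_eq_iff.1 h with ⟨h1, -⟩ | ⟨h1, h2⟩
  · exact hw h1
  · exact absurd (by rw [← hw h1, hw h2]) (add_one_add_one_ne_self hk r)

namespace IsWignerOfParameter

variable {Ω 𝕜 : Type*} [RCLike 𝕜] [MeasurableSpace 𝕜] [BorelSpace 𝕜] [MeasurableSpace Ω]
  {P : Measure Ω} {Y : ℕ+ → ℝ → Ω → ℝ} {Z : UpperPair → ℝ → Ω → 𝕜}
  {κ : ℝ} {c : ℝ → ℝ → ℝ}

theorem walkCov_one (hW : IsWignerOfParameter P Y Z κ c) (w : Fin 1 → ℕ+) (t t' : ℝ) :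
    walkCov P Y Z t t' w w = (((1 + κ) * c t t' : ℝ) : 𝕜) := by
  have h1 : periodize w 1 = periodize w 0 := rfl
  simp only [walkCov, cycleWeight, bilinCov, h1]
  rw [hW.integral_diag_mul, hW.integral_wignerMatrix, zero_mul, sub_zero]

variable [IsProbabilityMeasure P]

theorem integral_prod_of_injective (hW : IsWignerOfParameter P Y Z κ c) {ι : Type*}
    {e : ι → ℕ+ ⊕ UpperPair} (he : Function.Injective e) {F : ι → Ω → 𝕜}
    (hF : ∀ i, Measurable[entrySigma Y Z {e i}] (F i)) (T : Finset ι) :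
    ∫ ω, ∏ i ∈ T, F i ω ∂P = ∏ i ∈ T, ∫ ω, F i ω ∂P := by
  classical
  induction T using Finset.induction_on with
  | empty => simp
  | insert a T ha ih =>
    simp_rw [Finset.prod_insert ha]
    rw [← ih]
    refine hW.integral_mul_of_disjoint (S := {e a}) (T := e '' T) ?_ (hF a) ?_
    · rw [Set.disjoint_singleton_left]
      rintro ⟨i, hi, hia⟩
      exact ha (he hia ▸ hi)
    · refine @Finset.measurable_fun_prod 𝕜 ι Ω _ _ _ (entrySigma Y Z _) _ T fun i hi => ?_
      exact (hF i).mono (biSup_mono fun j hj => by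
        rw [Set.mem_singleton_iff.1 hj]
        exact ⟨i, hi, rfl⟩) le_rfl

variable (hW : IsWignerOfParameter P Y Z κ c) {k : ℕ} [NeZero k] {w : Fin k → ℕ+} {t t' : ℝ}
include hW

/-- Two simple cycles with the same edges, each edge of the second one either with the orientation
it has in the first or reversed. -/
theorem walkCov_eq_pow (hk : 3 ≤ k) (hw : Function.Injective w) {x : Fin k → ℕ+} {a : ℝ}
    {F : Fin k → Ω → 𝕜}
    (hx : ∀ ω, cycleWeight (wignerMatrix Y Z t' ω) (periodize x) k = ∏ s, F s ω)
    (hF : ∀ s, Measurable[entrySigma Y Z {entryLabel (w s) (w (s + 1))}] (F s))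
    (ha : ∀ s, ∫ ω, wignerMatrix Y Z t ω (w s) (w (s + 1)) * F s ω ∂P = (a : 𝕜)) :
    walkCov P Y Z t t' w x = ((a ^ k : ℝ) : 𝕜) := by
  have he := entryLabel_cycle_injective hk hw
  have hm : ∀ s, Measurable[entrySigma Y Z {entryLabel (w s) (w (s + 1))}]
      fun ω => wignerMatrix Y Z t ω (w s) (w (s + 1)) := fun s =>
    measurable_wignerMatrix_entrySigma (Set.mem_singleton _) t
  simp only [walkCov, bilinCov, hx, cycleWeight_periodize_eq_prod _ hk hw,
    ← Finset.prod_mul_distrib]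
  rw [hW.integral_prod_of_injective he (F := fun s ω => wignerMatrix Y Z t ω (w s) (w (s + 1))) hm,
    hW.integral_prod_of_injective he
      (F := fun s ω => wignerMatrix Y Z t ω (w s) (w (s + 1)) * F s ω) fun s => (hm s).mul (hF s),
    Finset.prod_congr rfl fun s _ => ha s,
    Finset.prod_eq_zero (f := fun s => ∫ ω, wignerMatrix Y Z t ω (w s) (w (s + 1)) ∂P)
      (Finset.mem_univ 0) (hW.integral_wignerMatrix t _ _), zero_mul, sub_zero]
  simp

theorem walkCov_rotation (hk : 3 ≤ k) (hw : Function.Injective w) (d : Fin k) :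
    walkCov P Y Z t t' w (fun r => w (d + r)) = (((κ * c t t') ^ k : ℝ) : 𝕜) := by
  refine hW.walkCov_eq_pow hk hw
    (F := fun s ω => wignerMatrix Y Z t' ω (w s) (w (s + 1))) (fun ω => ?_)
    (fun s => measurable_wignerMatrix_entrySigma (Set.mem_singleton _) t')
    fun s => hW.integral_mul_same (fun h => add_one_ne_self (by omega) s (hw h).symm) t t'
  rw [cycleWeight_periodize_eq_prod _ hk (w := fun r => w (d + r))
    (hw.comp (add_right_injective d))]
  simp_rw [← add_assoc]
  exact Equiv.prod_comp (Equiv.addLeft d) fun s => wignerMatrix Y Z t' ω (w s) (w (s + 1))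

theorem walkCov_reflection (hk : 3 ≤ k) (hw : Function.Injective w) (d : Fin k) :
    walkCov P Y Z t t' w (fun r => w (d - r)) = ((c t t' ^ k : ℝ) : 𝕜) := by
  refine hW.walkCov_eq_pow hk hw
    (F := fun s ω => wignerMatrix Y Z t' ω (w (s + 1)) (w s)) (fun ω => ?_)
    (fun s => measurable_wignerMatrix_entrySigma (by rw [entryLabel_comm]; rfl) t')
    fun s => hW.integral_mul_swap (fun h => add_one_ne_self (by omega) s (hw h).symm) t t'
  rw [cycleWeight_periodize_eq_prod _ hk (w := fun r => w (d - r))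
    (hw.comp (sub_right_injective (b := d))),
    ← (Equiv.subLeft (d - 1)).prod_comp fun s => wignerMatrix Y Z t' ω (w (s + 1)) (w s)]
  refine Finset.prod_congr rfl fun r _ => ?_
  simp only [Equiv.subLeft_apply]
  congr 2
  · abel
  · abel

theorem walkCov_two (w : Fin 2 → ℕ+) (hw : Function.Injective w) {x : Fin 2 → ℕ+}
    (hx : x = w ∨ x = fun r => w (1 + r)) :
    walkCov P Y Z t t' w x = (((1 + κ) * c t t' ^ 2 : ℝ) : 𝕜) := by
  have h01 : w 0 ≠ w 1 := fun h => absurd (hw h) (by decide)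
  have hcyc : ∀ (r : ℝ) (y : Fin 2 → ℕ+) ω,
      cycleWeight (wignerMatrix Y Z r ω) (periodize y) 2
        = wignerMatrix Y Z r ω (y 0) (y 1) * wignerMatrix Y Z r ω (y 1) (y 0) - 2 := by
    intro r y ω
    have h0 : periodize y 0 = y 0 := rfl
    have h1 : periodize y 1 = y 1 := rfl
    have h2 : periodize y 2 = y 0 := rfl
    have h3 : periodize y 3 = y 1 := rfl
    simp only [cycleWeight, pathWeight, zero_add, h0, h1, h2, h3, if_true]
    ring
  have hx' : ∀ ω, cycleWeight (wignerMatrix Y Z t' ω) (periodize x) 2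
      = wignerMatrix Y Z t' ω (w 0) (w 1) * wignerMatrix Y Z t' ω (w 1) (w 0) - 2 := by
    intro ω
    rcases hx with rfl | rfl
    · exact hcyc _ _ _
    · rw [hcyc]
      exact congrArg (· - 2) (mul_comm _ _)
  have hm (r : ℝ) : HasUniformMoments P fun (_ : Unit) ω =>
      wignerMatrix Y Z r ω (w 0) (w 1) * wignerMatrix Y Z r ω (w 1) (w 0) :=
    ((hW.hasUniformMoments_wignerMatrix r).comp fun _ => (w 0, w 1)).mul
      ((hW.hasUniformMoments_wignerMatrix r).comp fun _ => (w 1, w 0))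
  simp only [walkCov, hx', hcyc t w]
  rw [bilinCov_sub_const ((hm t).integrable ()) ((hm t').integrable ())
    (((hm t).mul (hm t')).integrable ()), bilinCov, hW.integral_sq_mul_sq h01,
    hW.integral_mul_swap h01, hW.integral_mul_swap h01, hW.cov_self, hW.cov_self]
  push_cast
  ring

/-- The contribution of a fixed simple cycle to the leading order. -/
theorem sum_walkCov_of_injective (hw : Function.Injective w) {T : Finset (Fin k → ℕ+)}
    (hT : ∀ x, x ∈ T ↔ Function.Injective x ∧ Finset.univ.image w = Finset.univ.image x) :
    ∑ x ∈ T, walkCov P Y Z t t' w x = ((k * (1 + κ) * c t t' ^ k : ℝ) : 𝕜) := by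
  classical
  have hrot : ∀ d : Fin k, (fun r => w (d + r)) ∈ T := fun d => by
    rw [hT, ← Function.comp_def, Finset.image_comp,
      Finset.image_univ_of_surjective (add_left_surjective d)]
    exact ⟨hw.comp (add_right_injective d), rfl⟩
  have hrotinj : Function.Injective fun (d : Fin k) r => w (d + r) := fun d d' h => by
    simpa using hw (congrFun h 0)
  have hσ : ∀ x ∈ T, ∃ σ : Fin k → Fin k, Function.Injective σ ∧ x = fun r => w (σ r) := by
    intro x hx
    obtain ⟨h1, h2⟩ := (hT x).1 hx
    have h3 : ∀ r, ∃ s, w s = x r := fun r => by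
      simpa using (h2.symm ▸ Finset.mem_image_of_mem x (Finset.mem_univ r) :
        x r ∈ Finset.univ.image w)
    choose σ hσ using h3
    exact ⟨σ, fun r s h => h1 (by rw [← hσ, ← hσ, h]), funext fun r => (hσ r).symm⟩
  -- For `k ≤ 2` the reflections are rotations, and the weights are not simply products.
  rcases Nat.lt_or_ge k 3 with hk | hk
  · have hall : ∀ d : Fin k, walkCov P Y Z t t' w (fun r => w (d + r))
        = (((1 + κ) * c t t' ^ k : ℝ) : 𝕜) := by
      intro d
      have hk0 := Nat.pos_of_neZero k
      interval_cases k
      · rw [pow_one, ← hW.walkCov_one w]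
        congr 1
        funext r
        congr 1
        exact Subsingleton.elim _ _
      · refine hW.walkCov_two w hw ?_
        fin_cases d
        · left; funext r; simp
        · right; rfl
    have hTeq : T = Finset.univ.image fun (d : Fin k) r => w (d + r) := by
      ext x
      refine ⟨fun hx => ?_, fun hx => ?_⟩
      · obtain ⟨σ, hσi, rfl⟩ := hσ x hx
        refine Finset.mem_image.2 ⟨σ 0, Finset.mem_univ _, funext fun r => congrArg w ?_⟩
        have hk0 := Nat.pos_of_neZero k
        interval_cases k
        · exact Subsingleton.elim _ _
        · exact fin_two_add_eq_apply σ hσi r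
      · obtain ⟨d, -, rfl⟩ := Finset.mem_image.1 hx
        exact hrot d
    rw [hTeq, Finset.sum_image fun a _ b _ h => hrotinj h, Finset.sum_congr rfl fun d _ => hall d]
    simp
    ring
  · have hrefl : ∀ d : Fin k, (fun r => w (d - r)) ∈ T := fun d => by
      rw [hT, ← Function.comp_def, Finset.image_comp,
        Finset.image_univ_of_surjective (f := HSub.hSub d) (Equiv.subLeft d).surjective]
      exact ⟨hw.comp (sub_right_injective (b := d)), rfl⟩
    have hreflinj : Function.Injective fun (d : Fin k) r => w (d - r) := fun d d' h => by
      simpa using hw (congrFun h 0)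
    rw [← Finset.sum_subset (s₁ := (Finset.univ.image fun (d : Fin k) r => w (d + r))
      ∪ Finset.univ.image fun (d : Fin k) r => w (d - r)), Finset.sum_union,
      Finset.sum_image fun a _ b _ h => hrotinj h, Finset.sum_image fun a _ b _ h => hreflinj h,
      Finset.sum_congr rfl fun d _ => hW.walkCov_rotation hk hw d,
      Finset.sum_congr rfl fun d _ => hW.walkCov_reflection hk hw d]
    -- As `κ` is `0` or `1`, the rotations contribute `k * κ * c ^ k`.
    · have hκ : κ ^ k = κ := by
        rcases hW.parameter with rfl | rfl
        · rw [zero_pow (by omega)]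
        · rw [one_pow]
      rw [mul_pow, hκ]
      simp
      ring
    · rw [Finset.disjoint_left]
      rintro x hx hx'
      obtain ⟨d, -, rfl⟩ := Finset.mem_image.1 hx
      obtain ⟨d', -, h⟩ := Finset.mem_image.1 hx'
      have h0 : d' = d := by simpa using hw (congrFun h 0)
      have h1 := hw (congrFun h 1)
      rw [h0, sub_eq_iff_eq_add] at h1
      exact add_one_add_one_ne_self hk d h1.symm
    · intro x hx
      rcases Finset.mem_union.1 hx with hx | hx
      · obtain ⟨d, -, rfl⟩ := Finset.mem_image.1 hx
        exact hrot d
      · obtain ⟨d, -, rfl⟩ := Finset.mem_image.1 hx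
        exact hrefl d
    · intro x hx hx'
      by_contra hne
      obtain ⟨σ, hσi, rfl⟩ := hσ x hx
      rw [walkCov_comm] at hne
      refine hx' (Finset.mem_union.2 ?_)
      refine (eq_add_or_eq_sub_of_steps hk hσi fun r => ?_).imp (fun h => ?_) fun h => ?_
      · obtain ⟨s, hs⟩ := hW.exists_edge_eq hne (s := r) fun j hj => hσi (hw hj)
        rcases entryLabel_eq_iff.1 hs with ⟨h1, h2⟩ | ⟨h1, h2⟩
        · left
          rw [← hw h1, hw h2]
        · right
          rw [← hw h2, ← hw h1, add_sub_cancel_right]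
      · exact Finset.mem_image.2 ⟨σ 0, Finset.mem_univ _, funext fun r => by rw [h r]⟩
      · exact Finset.mem_image.2 ⟨σ 0, Finset.mem_univ _, funext fun r => by rw [h r]⟩

end IsWignerOfParameter

/-! ### Chebyshev traces -/

section Expansion

open Polynomial

theorem span_chebyshev_T_eq_top :
    Submodule.span ℝ (Set.range fun j : ℕ => Chebyshev.T ℝ j) = ⊤ := by
  set S := Submodule.span ℝ (Set.range fun j : ℕ => Chebyshev.T ℝ j) with hS
  have hT : ∀ j : ℕ, Chebyshev.T ℝ j ∈ S := fun j => Submodule.subset_span ⟨j, rfl⟩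
  have hX : ∀ p ∈ S, X * p ∈ S := by
    intro p hp
    induction hp using Submodule.span_induction with
    | mem p hp =>
      obtain ⟨j, rfl⟩ := hp
      cases j with
      | zero => simpa using hT 1
      | succ j =>
        have h := Chebyshev.T_add_two ℝ j
        have h1 : X * Chebyshev.T ℝ ((j + 1 : ℕ) : ℤ)
            = (1 / 2 : ℝ) • (Chebyshev.T ℝ ((j + 2 : ℕ) : ℤ) + Chebyshev.T ℝ (j : ℤ)) := by
          push_cast
          rw [h, sub_add_cancel, mul_assoc, two_mul, smul_add, ← add_smul]
          norm_num
        simp only [h1]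
        exact S.smul_mem _ (S.add_mem (hT _) (hT _))
    | zero => simp
    | add p q _ _ hp hq => rw [mul_add]; exact S.add_mem hp hq
    | smul a p _ hp => rw [mul_smul_comm]; exact S.smul_mem a hp
  have hpow : ∀ n : ℕ, (X : ℝ[X]) ^ n ∈ S := by
    intro n
    induction n with
    | zero => simpa using hT 0
    | succ n ih => rw [pow_succ']; exact hX _ ih
  rw [eq_top_iff]
  intro p _
  rw [p.as_sum_range_C_mul_X_pow]
  refine S.sum_mem fun i _ => ?_
  rw [← smul_eq_C_mul]
  exact S.smul_mem _ (hpow i)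

/-- The polynomial `T_k(r x)` expanded in Chebyshev polynomials, with coefficients continuous in
`r`. -/
theorem exists_chebyshev_comp_expansion (k : ℕ) :
    ∃ (J : Finset ℕ) (α : ℕ → ℝ → ℝ), k ∈ J ∧ (∀ j, Continuous (α j)) ∧
      (∀ j, α j 1 = if j = k then 1 else 0) ∧
      ∀ r : ℝ, (Chebyshev.T ℝ k).comp (C r * X) = ∑ j ∈ J, α j r • Chebyshev.T ℝ j := by
  have hd : ∀ i : ℕ, ∃ d : ℕ →₀ ℝ, (d.sum fun j a => a • Chebyshev.T ℝ (j : ℤ)) = (X : ℝ[X]) ^ i :=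
    fun i => Finsupp.mem_span_range_iff_exists_finsupp.1
      (span_chebyshev_T_eq_top ▸ Submodule.mem_top)
  choose d hd using hd
  have hdeg : ∀ n, ¬ n < k + 1 → (Chebyshev.T ℝ (k : ℤ)).coeff n = 0 := by
    intro n hn
    refine coeff_eq_zero_of_natDegree_lt ?_
    rw [Chebyshev.natDegree_T]
    simp
    omega
  -- `T_k(r x) = T_k(x) + ∑ i, t_i (r ^ i - 1) x ^ i` makes the coefficients at `r = 1` evident.
  refine ⟨insert k ((Finset.range (k + 1)).biUnion fun i => (d i).support),
    fun j r => (if j = k then 1 else 0) + ∑ i ∈ Finset.range (k + 1),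
      (Chebyshev.T ℝ (k : ℤ)).coeff i * (r ^ i - 1) * d i j, Finset.mem_insert_self _ _,
    fun j => by fun_prop, fun j => by simp, fun r => ?_⟩
  set J := insert k ((Finset.range (k + 1)).biUnion fun i => (d i).support) with hJ
  have h1 : (Chebyshev.T ℝ k).comp (C r * X) = Chebyshev.T ℝ k + ∑ i ∈ Finset.range (k + 1),
      ((Chebyshev.T ℝ (k : ℤ)).coeff i * (r ^ i - 1)) • (X : ℝ[X]) ^ i := by
    ext n
    simp only [comp_C_mul_X_coeff, coeff_add, finsetSum_coeff, coeff_smul, coeff_X_pow,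
      smul_eq_mul, mul_ite, mul_one, mul_zero, Finset.sum_ite_eq, Finset.mem_range]
    split_ifs with hn
    · ring
    · rw [hdeg n hn]
      ring
  have h2 : ∀ i ∈ Finset.range (k + 1),
      (X : ℝ[X]) ^ i = ∑ j ∈ J, d i j • Chebyshev.T ℝ (j : ℤ) := by
    intro i hi
    rw [← hd i, Finsupp.sum]
    refine Finset.sum_subset ?_ fun j _ hj => by rw [Finsupp.notMem_support_iff.1 hj, zero_smul]
    exact fun j hj => Finset.mem_insert_of_mem (Finset.mem_biUnion.2 ⟨i, hi, hj⟩)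
  rw [h1, Finset.sum_congr rfl fun i hi => by rw [h2 i hi]]
  simp_rw [add_smul, Finset.sum_add_distrib, Finset.sum_smul, Finset.smul_sum, smul_smul]
  congr 1
  · simp [ite_smul, hJ]
  · exact Finset.sum_comm

end Expansion

section Trace

variable {Ω 𝕜 : Type*} [RCLike 𝕜] (Y : ℕ+ → ℝ → Ω → ℝ) (Z : UpperPair → ℝ → Ω → 𝕜)

theorem pathWeight_submatrix {V W R : Type*} [DecidableEq V] [DecidableEq W] [CommRing R]
    (X : Matrix V V R) {f : W → V} (hf : Function.Injective f) (u : ℕ → W) :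
    ∀ j, pathWeight (X.submatrix f f) u j = pathWeight X (fun i => f (u i)) j
  | 0 => rfl
  | 1 => rfl
  | j + 2 => by
    simp only [pathWeight, pathWeight_submatrix X hf u j, pathWeight_submatrix X hf u (j + 1),
      Matrix.submatrix_apply, hf.eq_iff]

theorem cycleWeight_submatrix {V W R : Type*} [DecidableEq V] [DecidableEq W] [CommRing R]
    (X : Matrix V V R) {f : W → V} (hf : Function.Injective f) (u : ℕ → W) :
    ∀ k, cycleWeight (X.submatrix f f) u k = cycleWeight X (fun i => f (u i)) k
  | 0 => rfl
  | 1 => rfl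
  | k + 2 => by
    simp only [cycleWeight, pathWeight_submatrix X hf, hf.eq_iff]

theorem chebyshevTrace_eq_sum_cycleWeight {k : ℕ} [NeZero k] {B : Finset ℕ+} (hB : B.Nonempty)
    (t : ℝ) (ω : Ω) :
    ((2 * √(B.card : ℝ) ^ k : ℝ) : 𝕜) * (chebyshevTrace Y Z k (2 * √(B.card : ℝ)) B t ω : 𝕜)
      = ∑ w ∈ Fintype.piFinset fun _ : Fin k => B,
        cycleWeight (wignerMatrix Y Z t ω) (periodize w) k := by
  obtain ⟨k, rfl⟩ : ∃ j, k = j + 1 := ⟨k - 1, by have := Nat.pos_of_neZero k; omega⟩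
  have : Nonempty B := hB.to_subtype
  rw [ofReal_chebyshevTrace, ← sum_univ_eq_sum_piFinset (k + 1) B fun w =>
    cycleWeight (wignerMatrix Y Z t ω) (periodize w) (k + 1)]
  have h := sum_cycleWeight_eq_trace (principalSub (wignerMatrix Y Z t ω) B) k
  rw [Fintype.card_coe] at h
  rw [← RCLike.real_smul_eq_coe_mul, ← h]
  refine Finset.sum_congr rfl fun w _ => ?_
  exact cycleWeight_submatrix _ Subtype.val_injective _ _

theorem chebyshevTrace_zero (a : ℝ) (B : Finset ℕ+) (t : ℝ) (ω : Ω) :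
    chebyshevTrace Y Z 0 a B t ω = B.card := by
  simp [chebyshevTrace, rescaledChebyshev]

/-- A change of scale expands a Chebyshev trace in Chebyshev traces of the new scale. -/
theorem chebyshevTrace_eq_sum {k : ℕ} {J : Finset ℕ} {α : ℕ → ℝ → ℝ}
    (h : ∀ r : ℝ, (Polynomial.Chebyshev.T ℝ k).comp (Polynomial.C r * Polynomial.X)
      = ∑ j ∈ J, α j r • Polynomial.Chebyshev.T ℝ j) {s : ℝ} (hs : s ≠ 0) (a : ℝ) (B : Finset ℕ+)
    (t : ℝ) :
    chebyshevTrace Y Z k a B t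
      = fun ω => ∑ j ∈ J, α j (s / a) * chebyshevTrace Y Z j s B t ω := by
  funext ω
  have h1 : rescaledChebyshev k a = ∑ j ∈ J, α j (s / a) • rescaledChebyshev j s := by
    have h2 : (Polynomial.C (s / a) * Polynomial.X : Polynomial ℝ).comp
        (Polynomial.C s⁻¹ * Polynomial.X) = Polynomial.C a⁻¹ * Polynomial.X := by
      rw [Polynomial.mul_comp, Polynomial.C_comp, Polynomial.X_comp, ← mul_assoc,
        ← Polynomial.C_mul]
      congr 2
      field_simp
    simp only [rescaledChebyshev]
    rw [← h2, ← Polynomial.comp_assoc, h, Polynomial.sum_comp]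
    simp only [Polynomial.smul_comp]
  simp only [chebyshevTrace, h1, map_sum, map_smul, Matrix.trace_sum, Matrix.trace_smul,
    RCLike.smul_re]

end Trace

namespace IsWignerOfParameter

variable {Ω 𝕜 : Type*} [RCLike 𝕜] [MeasurableSpace 𝕜] [BorelSpace 𝕜] [MeasurableSpace Ω]
  {P : Measure Ω} [IsProbabilityMeasure P] {Y : ℕ+ → ℝ → Ω → ℝ} {Z : UpperPair → ℝ → Ω → 𝕜}
  {κ : ℝ} {c : ℝ → ℝ → ℝ}

theorem memLp_chebyshevTrace_card (hW : IsWignerOfParameter P Y Z κ c) (k : ℕ) {B : Finset ℕ+}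
    (hB : B.Nonempty) (t : ℝ) :
    MemLp (chebyshevTrace Y Z k (2 * √(B.card : ℝ)) B t) 2 P := by
  rcases Nat.eq_zero_or_pos k with rfl | hk
  · have h : chebyshevTrace Y Z 0 (2 * √(B.card : ℝ)) B t = fun _ => (B.card : ℝ) :=
      funext fun ω => chebyshevTrace_zero Y Z _ B t ω
    rw [h]
    exact memLp_const _
  have : NeZero k := ⟨hk.ne'⟩
  have hpos : (0 : ℝ) < B.card := by exact_mod_cast hB.card_pos
  have hne : ((2 * √(B.card : ℝ) ^ k : ℝ) : 𝕜) ≠ 0 := by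
    rw [Ne, RCLike.ofReal_eq_zero]
    positivity
  have hsum : MemLp (fun ω => ∑ w ∈ Fintype.piFinset fun _ : Fin k => B,
      cycleWeight (wignerMatrix Y Z t ω) (periodize w) k) 2 P :=
    memLp_finsetSum _ fun w _ => (hasUniformMoments_cycleWeight
      (hW.hasUniformMoments_wignerMatrix t) k).memLp_two (periodize w)
  have h := (hsum.const_mul ((2 * √(B.card : ℝ) ^ k : ℝ) : 𝕜)⁻¹).re
  have heq : chebyshevTrace Y Z k (2 * √(B.card : ℝ)) B t = fun ω =>
      RCLike.re (((2 * √(B.card : ℝ) ^ k : ℝ) : 𝕜)⁻¹ * ∑ w ∈ Fintype.piFinset fun _ : Fin k => B,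
        cycleWeight (wignerMatrix Y Z t ω) (periodize w) k) := by
    funext ω
    rw [← chebyshevTrace_eq_sum_cycleWeight Y Z hB, inv_mul_cancel_left₀ hne, RCLike.ofReal_re]
  rw [heq]
  exact h

theorem memLp_chebyshevTrace (hW : IsWignerOfParameter P Y Z κ c) (k : ℕ) (a : ℝ) (B : Finset ℕ+)
    (t : ℝ) : MemLp (chebyshevTrace Y Z k a B t) 2 P := by
  rcases B.eq_empty_or_nonempty with rfl | hB
  · have h : chebyshevTrace Y Z k a ∅ t = fun _ => 0 := by
      funext ω
      simp [chebyshevTrace, Matrix.trace]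
    rw [h]
    exact memLp_const _
  · obtain ⟨J, α, -, -, -, hα⟩ := exists_chebyshev_comp_expansion k
    have hs : 2 * √(B.card : ℝ) ≠ 0 := by
      have hpos : (0 : ℝ) < B.card := by exact_mod_cast hB.card_pos
      positivity
    rw [chebyshevTrace_eq_sum Y Z hα hs a B t]
    exact memLp_finsetSum _ fun j _ => (hW.memLp_chebyshevTrace_card j hB t).const_mul _

/-- The leading term: such cycles have equal lengths and all their vertices in `B ∩ B'`. -/
theorem sum_walkCov_simple (hW : IsWignerOfParameter P Y Z κ c) (k l : ℕ) [NeZero k] [NeZero l]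
    (t t' : ℝ) (B B' : Finset ℕ+) :
    ∑ p ∈ (Fintype.piFinset (fun _ : Fin k => B) ×ˢ
        Fintype.piFinset (fun _ : Fin l => B')).filter (fun p => Function.Injective p.1 ∧
          Function.Injective p.2 ∧ Finset.univ.image p.1 = Finset.univ.image p.2),
      walkCov P Y Z t t' p.1 p.2 = ((if k = l then ((B ∩ B').card.descFactorial k : ℝ)
        * (k * (1 + κ) * c t t' ^ k) else 0 : ℝ) : 𝕜) := by
  split_ifs with hkl
  · subst hkl
    rw [Finset.sum_filter, Finset.sum_product, ← Finset.sum_subset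
      (s₁ := (Fintype.piFinset fun _ : Fin k => B ∩ B').filter Function.Injective)]
    · rw [Finset.sum_congr rfl (g := fun _ => ((k * (1 + κ) * c t t' ^ k : ℝ) : 𝕜))]
      · rw [Finset.sum_const, card_filter_injective_piFinset, nsmul_eq_mul]
        push_cast
        rfl
      · intro w hw
        obtain ⟨hwB, hwi⟩ := Finset.mem_filter.1 hw
        rw [← Finset.sum_filter]
        refine hW.sum_walkCov_of_injective hwi fun x => ?_
        rw [Finset.mem_filter]
        refine ⟨fun h => h.2.2, fun h => ⟨Fintype.mem_piFinset.2 fun i => ?_, hwi, h⟩⟩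
        obtain ⟨j, -, hj⟩ := Finset.mem_image.1
          (h.2 ▸ Finset.mem_image_of_mem x (Finset.mem_univ i) : x i ∈ Finset.univ.image w)
        rw [← hj]
        exact Finset.mem_of_mem_inter_right (Fintype.mem_piFinset.1 hwB j)
    · intro w hw
      exact Fintype.mem_piFinset.2 fun i => Finset.mem_of_mem_inter_left
        (Fintype.mem_piFinset.1 (Finset.mem_filter.1 hw).1 i)
    · intro w hw hw'
      refine Finset.sum_eq_zero fun x hx => if_neg fun h => hw' ?_
      refine Finset.mem_filter.2 ⟨Fintype.mem_piFinset.2 fun i => ?_, h.1⟩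
      obtain ⟨j, -, hj⟩ := Finset.mem_image.1
        (h.2.2 ▸ Finset.mem_image_of_mem w (Finset.mem_univ i) : w i ∈ Finset.univ.image x)
      exact Finset.mem_inter.2 ⟨Fintype.mem_piFinset.1 hw i, hj ▸ Fintype.mem_piFinset.1 hx j⟩
  · rw [Finset.filter_false_of_mem, Finset.sum_empty, RCLike.ofReal_zero]
    rintro ⟨w, x⟩ - ⟨h1, h2, h3⟩
    refine hkl ?_
    simpa [Finset.card_image_of_injective _ h1, Finset.card_image_of_injective _ h2]
      using congrArg Finset.card h3

/-- The covariance of two Chebyshev traces, up to an error of smaller order. -/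
theorem exists_abs_covariance_sub_le (hW : IsWignerOfParameter P Y Z κ c) (k l : ℕ) [NeZero k]
    [NeZero l] (t t' : ℝ) : ∃ C : ℝ, ∀ B B' : Finset ℕ+, B.Nonempty → B'.Nonempty →
      |4 * (√(B.card : ℝ) ^ k * √(B'.card : ℝ) ^ l)
          * cov[chebyshevTrace Y Z k (2 * √(B.card : ℝ)) B t,
            chebyshevTrace Y Z l (2 * √(B'.card : ℝ)) B' t'; P]
        - if k = l then ((B ∩ B').card.descFactorial k : ℝ) * (k * (1 + κ) * c t t' ^ k) else 0|
      ≤ C * ((B ∪ B').card : ℝ) ^ ((k + l - 1) / 2) := by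
  obtain ⟨C, hC⟩ := hW.exists_norm_sum_walkCov_sub_le k l t t'
  refine ⟨C, fun B B' hB hB' => ?_⟩
  have h := hC B B'
  rw [hW.sum_walkCov_simple, Finset.sum_product] at h
  have hsum := bilinCov_sum_sum (s := Fintype.piFinset fun _ : Fin k => B)
    (t := Fintype.piFinset fun _ : Fin l => B')
    ((hasUniformMoments_cycleWeight (hW.hasUniformMoments_wignerMatrix t) k).comp
      (periodize (k := k)))
    ((hasUniformMoments_cycleWeight (hW.hasUniformMoments_wignerMatrix t') l).comp
      (periodize (k := l)))
  simp only [walkCov] at h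
  rw [← hsum] at h
  simp_rw [← chebyshevTrace_eq_sum_cycleWeight Y Z hB, ← chebyshevTrace_eq_sum_cycleWeight Y Z hB']
    at h
  rw [← RCLike.norm_ofReal (K := 𝕜), RCLike.ofReal_sub, RCLike.ofReal_mul,
    ofReal_covariance_eq_bilinCov (𝕜 := 𝕜) (hW.memLp_chebyshevTrace_card k hB t)
      (hW.memLp_chebyshevTrace_card l hB' t')]
  convert h using 3
  rw [bilinCov_const_mul]
  push_cast
  ring

end IsWignerOfParameter

/-! ### The limit -/

section Asymptotics

theorem tendsto_descFactorial_div_pow {f : ℝ → ℕ} {b : ℝ}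
    (hf : Tendsto (fun L => (f L : ℝ) / L) atTop (𝓝 b)) (k : ℕ) :
    Tendsto (fun L => ((f L).descFactorial k : ℝ) / L ^ k) atTop (𝓝 (b ^ k)) := by
  induction k with
  | zero => simp
  | succ k ih =>
    have h1 : Tendsto (fun L => ((f L - k : ℕ) : ℝ) / L) atTop (𝓝 b) := by
      have h2 : Tendsto (fun L : ℝ => (f L : ℝ) / L - k / L) atTop (𝓝 (b - 0)) :=
        hf.sub (tendsto_const_nhds.div_atTop tendsto_id)
      rw [sub_zero] at h2
      refine tendsto_of_tendsto_of_tendsto_of_le_of_le' h2 hf ?_ ?_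
      · filter_upwards [eventually_gt_atTop 0] with L hL
        rw [← sub_div]
        refine div_le_div_of_nonneg_right ?_ hL.le
        rw [sub_le_iff_le_add]
        exact_mod_cast (by omega : f L ≤ f L - k + k)
      · filter_upwards [eventually_gt_atTop 0] with L hL
        exact div_le_div_of_nonneg_right (by exact_mod_cast Nat.sub_le _ _) hL.le
    rw [pow_succ']
    refine (h1.mul ih).congr fun L => ?_
    rw [Nat.descFactorial_succ, pow_succ', Nat.cast_mul, div_mul_div_comm]

theorem tendsto_sqrt_div_sqrt {f : ℝ → ℕ} {b : ℝ}
    (hf : Tendsto (fun L => (f L : ℝ) / L) atTop (𝓝 b)) :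
    Tendsto (fun L => √(f L : ℝ) / √L) atTop (𝓝 √b) :=
  (hf.sqrt).congr fun L => Real.sqrt_div (Nat.cast_nonneg _) L

theorem eventually_nonempty_of_tendsto {V : Type*} {B : ℝ → Finset V} {b : ℝ} (hb : 0 < b)
    (hB : Tendsto (fun L => ((B L).card : ℝ) / L) atTop (𝓝 b)) : ∀ᶠ L in atTop, (B L).Nonempty := by
  filter_upwards [hB.eventually (lt_mem_nhds hb)] with L hL
  rw [Finset.nonempty_iff_ne_empty]
  rintro h
  simp [h] at hL

theorem tendsto_pow_div_sqrt_pow {f : ℝ → ℕ} {d : ℝ}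
    (hf : ∀ᶠ L in atTop, (f L : ℝ) / L ≤ d) {r n : ℕ} (hn : 2 * r < n) :
    Tendsto (fun L => (f L : ℝ) ^ r / √L ^ n) atTop (𝓝 0) := by
  have h1 : Tendsto (fun L : ℝ => d ^ r * (√L)⁻¹) atTop (𝓝 (d ^ r * 0)) :=
    (tendsto_inv_atTop_zero.comp Real.tendsto_sqrt_atTop).const_mul _
  rw [mul_zero] at h1
  refine squeeze_zero' ?_ ?_ h1
  · filter_upwards [eventually_gt_atTop 0] with L hL
    positivity
  · filter_upwards [eventually_ge_atTop 1, hf] with L hL hd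
    have hL0 : 0 < L := by linarith
    have hs : 1 ≤ √L := Real.one_le_sqrt.2 hL
    have h2 : √L ^ n = L ^ r * √L ^ (n - 2 * r) := by
      conv_lhs => rw [← Nat.add_sub_cancel' hn.le, pow_add, pow_mul, Real.sq_sqrt hL0.le]
    have h3 : √L ≤ √L ^ (n - 2 * r) := le_self_pow₀ hs (by omega)
    rw [h2, ← div_div, ← div_pow, div_eq_mul_inv]
    refine mul_le_mul (pow_le_pow_left₀ (by positivity) hd r) (inv_anti₀ (by positivity) h3)
      (by positivity) ?_
    exact pow_nonneg ((by positivity : (0 : ℝ) ≤ (f L : ℝ) / L).trans hd) r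

end Asymptotics

namespace IsWignerOfParameter

variable {Ω 𝕜 : Type*} [RCLike 𝕜] [MeasurableSpace 𝕜] [BorelSpace 𝕜] [MeasurableSpace Ω]
  {P : Measure Ω} [IsProbabilityMeasure P] {Y : ℕ+ → ℝ → Ω → ℝ} {Z : UpperPair → ℝ → Ω → 𝕜}
  {κ : ℝ} {c : ℝ → ℝ → ℝ} (hW : IsWignerOfParameter P Y Z κ c)
  {B B' : ℝ → Finset ℕ+} {b b' bb : ℝ} (hb : 0 < b) (hb' : 0 < b')
  (hB : Tendsto (fun L => ((B L).card : ℝ) / L) atTop (𝓝 b))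
  (hB' : Tendsto (fun L => ((B' L).card : ℝ) / L) atTop (𝓝 b'))
  (hBB' : Tendsto (fun L => ((B L ∩ B' L).card : ℝ) / L) atTop (𝓝 bb))
include hW hb hb' hB hB' hBB'

/-- The limit covariance when the matrices are scaled by their actual sizes. -/
theorem tendsto_covariance_card (k l : ℕ) (t t' : ℝ) :
    Tendsto (fun L => cov[chebyshevTrace Y Z k (2 * √((B L).card : ℝ)) (B L) t,
        chebyshevTrace Y Z l (2 * √((B' L).card : ℝ)) (B' L) t'; P]) atTop
      (𝓝 (if k = l then (k : ℝ) * (1 + κ) / 4 * (c t t' * bb / √(b * b')) ^ k else 0)) := by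
  have hconst (a : ℝ) (D : Finset ℕ+) (r : ℝ) :
      chebyshevTrace Y Z 0 a D r = fun _ => (D.card : ℝ) :=
    funext fun ω => chebyshevTrace_zero Y Z a D r ω
  rcases Nat.eq_zero_or_pos k with rfl | hk
  · simp [hconst, covariance_const_left]
  rcases Nat.eq_zero_or_pos l with rfl | hl
  · simp [hconst, covariance_const_right, hk.ne']
  have : NeZero k := ⟨hk.ne'⟩
  have : NeZero l := ⟨hl.ne'⟩
  obtain ⟨C, hC⟩ := hW.exists_abs_covariance_sub_le k l t t'
  set V : ℝ → ℝ := fun L => cov[chebyshevTrace Y Z k (2 * √((B L).card : ℝ)) (B L) t,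
    chebyshevTrace Y Z l (2 * √((B' L).card : ℝ)) (B' L) t'; P] with hV
  set D : ℝ → ℝ := fun L => √((B L).card : ℝ) ^ k * √((B' L).card : ℝ) ^ l with hD
  set M : ℝ → ℝ := fun L => if k = l then ((B L ∩ B' L).card.descFactorial k : ℝ)
    * (k * (1 + κ) * c t t' ^ k) else 0 with hM
  have hne := eventually_nonempty_of_tendsto hb hB
  have hne' := eventually_nonempty_of_tendsto hb' hB'
  have hcard : ∀ᶠ L in atTop, ((B L ∪ B' L).card : ℝ) / L ≤ b + b' + 1 := by
    filter_upwards [(hB.add hB').eventually (ge_mem_nhds (lt_add_one (b + b'))),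
      eventually_gt_atTop 0] with L hL hL0
    refine le_trans ?_ hL
    rw [← add_div]
    refine div_le_div_of_nonneg_right ?_ hL0.le
    exact_mod_cast Finset.card_union_le _ _
  have herr : Tendsto (fun L => (4 * D L * V L - M L) / √L ^ (k + l)) atTop (𝓝 0) := by
    have h1 := (tendsto_pow_div_sqrt_pow hcard (r := (k + l - 1) / 2) (n := k + l)
      (by omega)).const_mul C
    rw [mul_zero] at h1
    refine squeeze_zero_norm' ?_ h1
    filter_upwards [hne, hne'] with L h2 h3
    rw [norm_div, Real.norm_eq_abs, Real.norm_of_nonneg (by positivity : 0 ≤ √L ^ (k + l)),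
      ← mul_div_assoc]
    exact div_le_div_of_nonneg_right (hC _ _ h2 h3) (by positivity)
  have hden : Tendsto (fun L => 4 * (D L / √L ^ (k + l))) atTop (𝓝 (4 * (√b ^ k * √b' ^ l))) := by
    refine Tendsto.const_mul _ ?_
    refine (((tendsto_sqrt_div_sqrt hB).pow k).mul ((tendsto_sqrt_div_sqrt hB').pow l)).congr
      fun L => ?_
    rw [div_pow, div_pow, div_mul_div_comm, ← pow_add]
  have hmain : Tendsto (fun L => M L / √L ^ (k + l)) atTop
      (𝓝 (if k = l then bb ^ k * (k * (1 + κ) * c t t' ^ k) else 0)) := by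
    by_cases hkl : k = l
    · subst hkl
      simp only [hM, if_true]
      refine ((tendsto_descFactorial_div_pow hBB' k).mul_const _).congr' ?_
      filter_upwards [eventually_ge_atTop 0] with L hL
      rw [← two_mul, pow_mul, Real.sq_sqrt hL, div_mul_eq_mul_div]
    · simp [hM, hkl]
  have hsb : 0 < √b := Real.sqrt_pos.2 hb
  have hsb' : 0 < √b' := Real.sqrt_pos.2 hb'
  have hlim := (herr.add hmain).div hden (by positivity)
  have hval : (0 + if k = l then bb ^ k * (k * (1 + κ) * c t t' ^ k) else 0)
      / (4 * (√b ^ k * √b' ^ l))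
      = if k = l then (k : ℝ) * (1 + κ) / 4 * (c t t' * bb / √(b * b')) ^ k else 0 := by
    split_ifs with hkl
    · subst hkl
      rw [Real.sqrt_mul hb.le, div_pow, mul_pow, mul_pow]
      field_simp
      ring
    · simp
  rw [hval] at hlim
  refine hlim.congr' ?_
  filter_upwards [hne, hne', eventually_gt_atTop 0] with L h1 h2 h3
  have h4 : (0 : ℝ) < (B L).card := by exact_mod_cast h1.card_pos
  have h5 : (0 : ℝ) < (B' L).card := by exact_mod_cast h2.card_pos
  have h6 : 0 < D L := by positivity
  have h7 : 0 < √L ^ (k + l) := by positivity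
  simp only [Pi.div_apply]
  field_simp
  ring

/-- The limit covariance when the matrices are scaled by their asymptotic sizes. -/
theorem tendsto_covariance (k l : ℕ) (t t' : ℝ) :
    Tendsto (fun L => cov[chebyshevTrace Y Z k (2 * √(b * L)) (B L) t,
        chebyshevTrace Y Z l (2 * √(b' * L)) (B' L) t'; P]) atTop
      (𝓝 (if k = l then (k : ℝ) * (1 + κ) / 4 * (c t t' * bb / √(b * b')) ^ k else 0)) := by
  obtain ⟨J, α, hkJ, hαc, hα1, hα⟩ := exists_chebyshev_comp_expansion k
  obtain ⟨J', α', hlJ, hαc', hα1', hα'⟩ := exists_chebyshev_comp_expansion l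
  have hratio {A : ℝ → Finset ℕ+} {a : ℝ} (ha : 0 < a)
      (hA : Tendsto (fun L => ((A L).card : ℝ) / L) atTop (𝓝 a)) :
      Tendsto (fun L => 2 * √((A L).card : ℝ) / (2 * √(a * L))) atTop (𝓝 1) := by
    have hsa : √a ≠ 0 := (Real.sqrt_pos.2 ha).ne'
    have h := (tendsto_sqrt_div_sqrt hA).div_const √a
    rw [div_self hsa] at h
    refine h.congr fun L => ?_
    rw [mul_div_mul_left _ _ two_ne_zero, Real.sqrt_mul ha.le, div_div, mul_comm √L]
  have hlim : Tendsto (fun L => ∑ j ∈ J, ∑ i ∈ J',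
      α j (2 * √((B L).card : ℝ) / (2 * √(b * L)))
        * (α' i (2 * √((B' L).card : ℝ) / (2 * √(b' * L)))
          * cov[chebyshevTrace Y Z j (2 * √((B L).card : ℝ)) (B L) t,
            chebyshevTrace Y Z i (2 * √((B' L).card : ℝ)) (B' L) t'; P])) atTop
      (𝓝 (∑ j ∈ J, ∑ i ∈ J', α j 1 * (α' i 1 *
        if j = i then (j : ℝ) * (1 + κ) / 4 * (c t t' * bb / √(b * b')) ^ j else 0))) :=
    tendsto_finsetSum _ fun j _ => tendsto_finsetSum _ fun i _ =>
      (((hαc j).tendsto 1).comp (hratio hb hB)).mul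
        ((((hαc' i).tendsto 1).comp (hratio hb' hB')).mul
          (hW.tendsto_covariance_card hb hb' hB hB' hBB' j i t t'))
  have hval : (∑ j ∈ J, ∑ i ∈ J', α j 1 * (α' i 1 *
        if j = i then (j : ℝ) * (1 + κ) / 4 * (c t t' * bb / √(b * b')) ^ j else 0))
      = if k = l then (k : ℝ) * (1 + κ) / 4 * (c t t' * bb / √(b * b')) ^ k else 0 := by
    rw [Finset.sum_eq_single_of_mem k hkJ, Finset.sum_eq_single_of_mem l hlJ]
    · simp [hα1, hα1']
    · intro i _ hi
      simp [hα1', hi]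
    · intro j _ hj
      simp [hα1, hj]
  rw [hval] at hlim
  refine hlim.congr' ?_
  filter_upwards [eventually_nonempty_of_tendsto hb hB, eventually_nonempty_of_tendsto hb' hB']
    with L h1 h2
  have h4 : (0 : ℝ) < (B L).card := by exact_mod_cast h1.card_pos
  have h5 : (0 : ℝ) < (B' L).card := by exact_mod_cast h2.card_pos
  rw [chebyshevTrace_eq_sum Y Z hα (s := 2 * √((B L).card : ℝ)) (by positivity)
      (2 * √(b * L)) (B L) t,
    chebyshevTrace_eq_sum Y Z hα' (s := 2 * √((B' L).card : ℝ)) (by positivity)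
      (2 * √(b' * L)) (B' L) t',
    covariance_fun_sum_fun_sum' (fun j _ => (hW.memLp_chebyshevTrace_card j h1 t).const_mul _)
      fun i _ => (hW.memLp_chebyshevTrace_card i h2 t').const_mul _]
  simp_rw [covariance_const_mul_left, covariance_const_mul_right]

end IsWignerOfParameter

theorem proposition3 {Ω : Type*} [MeasurableSpace Ω] (P : Measure Ω) [IsProbabilityMeasure P]
    (m : ℕ) (k : Fin m → ℕ) (hk : ∀ p, 1 ≤ k p) (t : Fin m → ℝ)
    (B : Fin m → ℝ → Finset ℕ+) (b : Fin m → ℝ) (bb : Fin m → Fin m → ℝ)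
    (hb_pos : ∀ p, 0 < b p)
    (hb : ∀ p, Tendsto (fun L : ℝ => ((B p L).card : ℝ) / L) atTop (𝓝 (b p)))
    (hbb : ∀ p q, Tendsto (fun L : ℝ => ((B p L ∩ B q L).card : ℝ) / L) atTop (𝓝 (bb p q))) :
    -- real symmetric case, β = 1
    (∀ (Y : ℕ+ → ℝ → Ω → ℝ) (Z : UpperPair → ℝ → Ω → ℝ), IsRealWigner P Y Z →
      (∀ p (L : ℝ), 0 < L →
        MemLp (chebyshevTrace Y Z (k p) (2 * √(b p * L)) (B p L) (t p)) 2 P) ∧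
      ∀ p q, Tendsto
        (fun L : ℝ =>
          cov[chebyshevTrace Y Z (k p) (2 * √(b p * L)) (B p L) (t p),
            chebyshevTrace Y Z (k q) (2 * √(b q * L)) (B q L) (t q); P])
        atTop
        (𝓝 (if k p = k q then
          (k p : ℝ) / (2 * 1) *
            (diagCov P 1 Y (t p) (t q) * bb p q / √(b p * b q)) ^ k p
          else 0))) ∧
    -- Hermitian case, β = 2
    (∀ (Y : ℕ+ → ℝ → Ω → ℝ) (Z : UpperPair → ℝ → Ω → ℂ), IsHermitianWigner P Y Z →
      (∀ p (L : ℝ), 0 < L →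
        MemLp (chebyshevTrace Y Z (k p) (2 * √(b p * L)) (B p L) (t p)) 2 P) ∧
      ∀ p q, Tendsto
        (fun L : ℝ =>
          cov[chebyshevTrace Y Z (k p) (2 * √(b p * L)) (B p L) (t p),
            chebyshevTrace Y Z (k q) (2 * √(b q * L)) (B q L) (t q); P])
        atTop
        (𝓝 (if k p = k q then
          (k p : ℝ) / (2 * 2) *
            (diagCov P 2 Y (t p) (t q) * bb p q / √(b p * b q)) ^ k p
          else 0))) := by
  refine ⟨fun Y Z h => ⟨fun p L _ => h.isWignerOfParameter.memLp_chebyshevTrace _ _ _ _,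
    fun p q => ?_⟩, fun Y Z h => ⟨fun p L _ => h.isWignerOfParameter.memLp_chebyshevTrace _ _ _ _,
    fun p q => ?_⟩⟩
  · convert h.isWignerOfParameter.tendsto_covariance (hb_pos p) (hb_pos q) (hb p) (hb q) (hbb p q)
      (k p) (k q) (t p) (t q) using 3
    ring_nf
  · convert h.isWignerOfParameter.tendsto_covariance (hb_pos p) (hb_pos q) (hb p) (hb q) (hbb p q)
      (k p) (k q) (t p) (t q) using 3
    ring_nf
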